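/- For a finite Borel measure $\mu$ on $\mathbb{C}$ with compact support put $I(\mu)=\iint \log|z-w|\,d\mu(z)\,d\mu(w)\in[-\infty,\infty)$. A set $E\subset\mathbb{C}$ is polar if $I(\mu)=-\infty$ for every nonzero finite Borel measure $\mu$ with compact support contained in $E$, and $\mathrm{Cap}(E)=\sup_\mu e^{I(\mu)}$, the supremum being over Borel probability measures $\mu$ with compact support contained in $E$ (with $e^{-\infty}=0$ and $\sup\emptyset=0$). For a non-polar compact set $K\subset\mathbb{C}$, let $\mu_K$ be its equilibrium measure, i.e. the (unique) Borel probability measure supported in $K$ that maximizes $I$. For a Borel probability measure $\mu$ with infinite compact support and $n\in\mathbb{N}=\{0,1,2,\dots\}$, let $P_n(\cdot;\mu)$ be the $n$-th monic orthogonal polynomial, i.e. the monic complex polynomial of degree $n$ with least $L^2(\mu)$-norm, and, if $\mathrm{Cap}(\mathrm{supp}\,\mu)>0$, put $$W_n(\mu)=\frac{\|P_n(\cdot;\mu)\|_{L^2(\mu)}}{\mathrm{Cap}(\mathrm{supp}\,\mu)^n}.$$ Corollary 1.4. For every non-polar compact set $K\subset\mathbb{C}$, $$\inf_{n\in\mathbb{N}}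 W_n(\mu_K)\ge 1,$$ and $\|P_n(\cdot;\mu_K)\|_{L^2(\mu_K)}\ge \mathrm{Cap}(K)^n$ for all $n\in\mathbb{N}$. The bound is sharp: the unit circle $\mathbb{T}$ is non-polar, $\mu_{\mathbb{T}}=d\theta/(2\pi)$, and $W_n(\mu_{\mathbb{T}})=1$ for all $n\in\mathbb{N}$. -/

import Mathlib

open MeasureTheory Polynomial
open scoped ENNReal

namespace LogPotential

/-- The logarithmic kernel `log |z - w|` with values in `[-∞, ∞]`; it is `-∞` on the diagonal
(`ENNReal.log 0 = ⊥`). -/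
noncomputable def logKernel (z w : ℂ) : EReal :=
  ENNReal.log ‖z - w‖ₑ

/-- The logarithmic energy `I(μ) = ∬ log |z - w| dμ(z) dμ(w)`, the integral of the positive part
minus the integral of the negative part. For a finite measure of compact support the former is
finite, so that `I(μ)` lies in `[-∞, ∞)`. -/
noncomputable def energy (μ : Measure ℂ) : EReal :=
  ((∫⁻ z, ∫⁻ w, (logKernel z w).toENNReal ∂μ ∂μ : ℝ≥0∞) : EReal) -
    ((∫⁻ z, ∫⁻ w, (-logKernel z w).toENNReal ∂μ ∂μ : ℝ≥0∞) : EReal)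

/-- The measure `μ` has compact support, contained in `E`. -/
def CompactlySupportedIn (E : Set ℂ) (μ : Measure ℂ) : Prop :=
  IsCompact μ.support ∧ μ.support ⊆ E

/-- `E` is polar: every nonzero finite Borel measure with compact support in `E` has
energy `-∞`. -/
def IsPolar (E : Set ℂ) : Prop :=
  ∀ μ : Measure ℂ, IsFiniteMeasure μ → μ ≠ 0 → CompactlySupportedIn E μ → energy μ = ⊥

/-- The logarithmic capacity `Cap(E) = sup e^{I(μ)}`, over the Borel probability measures `μ` with
compact support in `E` (and `e^{-∞} = 0`). -/
noncomputable def capacity (E : Set ℂ) : ℝ≥0∞ :=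
  ⨆ (μ : Measure ℂ) (_ : IsProbabilityMeasure μ) (_ : CompactlySupportedIn E μ),
    EReal.exp (energy μ)

/-- `μ` is an equilibrium measure of `K`: it has the largest energy among the Borel probability
measures with compact support in `K`. -/
def IsEquilibriumMeasure (K : Set ℂ) (μ : Measure ℂ) : Prop :=
  IsProbabilityMeasure μ ∧ CompactlySupportedIn K μ ∧
    ∀ ν : Measure ℂ, IsProbabilityMeasure ν → CompactlySupportedIn K ν → energy ν ≤ energy μ

open Classical in
/-- The equilibrium measure `μ_K` of `K` (and `0` if `K` has none). For compact non-polar `K` it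
exists and is unique. -/
noncomputable def equilibriumMeasure (K : Set ℂ) : Measure ℂ :=
  if h : ∃ μ, IsEquilibriumMeasure K μ then h.choose else 0

/-- The norm `‖P‖_{L²(ℂ; μ)}` of a polynomial. -/
noncomputable def polyNorm (P : ℂ[X]) (μ : Measure ℂ) : ℝ≥0∞ :=
  eLpNorm (fun z => P.eval z) 2 μ

/-- `P` is a monic polynomial of degree `n` whose `L²(μ)`-norm is the least among all monic
polynomials of degree `n`. -/
def IsMonicMinimizer (n : ℕ) (μ : Measure ℂ) (P : ℂ[X]) : Prop :=
  P.Monic ∧ P.natDegree = n ∧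
    ∀ Q : ℂ[X], Q.Monic → Q.natDegree = n → polyNorm P μ ≤ polyNorm Q μ

open Classical in
/-- The `n`-th monic orthogonal polynomial `P_n(·; μ)`, the minimizer of the `L²(μ)`-norm among
monic polynomials of degree `n` (and `0` if there is none). -/
noncomputable def orthoPoly (n : ℕ) (μ : Measure ℂ) : ℂ[X] :=
  if h : ∃ P, IsMonicMinimizer n μ P then h.choose else 0

/-- The Widom factor `W_n(μ) = ‖P_n(·; μ)‖_{L²(μ)} / Cap(supp μ)^n`. -/
noncomputable def widomFactor (n : ℕ) (μ : Measure ℂ) : ℝ≥0∞ :=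
  polyNorm (orthoPoly n μ) μ / capacity μ.support ^ n

/-- The measure `dθ / 2π` on the unit circle, as a Borel measure on `ℂ`. -/
noncomputable def arcMeasure : Measure ℂ :=
  ENNReal.ofReal (1 / (2 * Real.pi)) •
    (volume.restrict (Set.Ico (0 : ℝ) (2 * Real.pi))).map
      (fun θ : ℝ => Complex.exp (θ * Complex.I))

end LogPotential

/-! The key is Frostman's theorem in its everywhere form: the potential `U(z) = ∫ log |z - w|
dμ_K(w)` satisfies `U ≥ I(μ_K) = log Cap(K)` on all of `ℂ`. For a monic `P` with roots `a_j`, `∫ log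
|P| dμ_K = ∑ U(a_j) ≥ n log Cap(K)`; Jensen's inequality and `‖·‖₁ ≤ ‖·‖₂` then give `‖P‖₂ ≥
Cap(K)^n` (`exp_pow_le_polyNorm`). Since `μ_K` is also an equilibrium measure of its own support,
`Cap(supp μ_K) = Cap(K)`.

Frostman's bound has two halves. Varying `μ_K` by mass placed where the potential is unfavourable
gives equality almost everywhere, and semicontinuity gives `U ≥ I(μ_K)` on the support
(`le_potential_on_support`). A minimum principle carries the bound to the complement, where `U` has
the mean value property (`le_potential_of_le_on_support`).

On the circle `U(0) = 0` forces energy `0`, and the minimum principle forces `U = 0` in the disc.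
Expanding the logarithm kills all moments of positive order, so `μ_𝕋` is arc length
(`equilibriumMeasure_sphere`), and `X ^ n` has norm `1`. -/

namespace LogPotential

open Filter Topology Set
open scoped NNReal

/-! ### Nonnegative kernels and the energy. -/

/-- The nonnegative logarithmic kernel `log⁺ (R / |z - w|)`, equal to `∞` on the diagonal. -/
noncomputable def kernel (R : ℝ) (z w : ℂ) : ℝ≥0∞ :=
  (ENNReal.log (ENNReal.ofReal R / ‖z - w‖ₑ)).toENNReal

/-- The potential of `μ` for the kernel `kernel R`. -/
noncomputable def kernelPotential (R : ℝ) (μ : Measure ℂ) (z : ℂ) : ℝ≥0∞ :=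
  ∫⁻ w, kernel R z w ∂μ

/-- The energy of `μ` for the kernel `kernel R`. -/
noncomputable def kernelEnergy (R : ℝ) (μ : Measure ℂ) : ℝ≥0∞ :=
  ∫⁻ z, kernelPotential R μ z ∂μ

theorem kernel_of_ne {R : ℝ} (hR : 0 < R) {z w : ℂ} (h : z ≠ w) :
    kernel R z w = ENNReal.ofReal (Real.log R - Real.log ‖z - w‖) := by
  have h0 : 0 < ‖z - w‖ := norm_pos_iff.2 (sub_ne_zero.2 h)
  rw [kernel, ← ofReal_norm, ← ENNReal.ofReal_div_of_pos h0,
    ENNReal.log_ofReal_of_pos (div_pos hR h0), EReal.real_coe_toENNReal,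
    Real.log_div hR.ne' h0.ne']

theorem kernel_self {R : ℝ} (hR : 0 < R) (z : ℂ) : kernel R z z = ⊤ := by
  have : ENNReal.ofReal R ≠ 0 := by simpa using hR
  simp [kernel, ENNReal.div_zero this]

theorem kernel_comm (R : ℝ) (z w : ℂ) : kernel R z w = kernel R w z := by
  rw [kernel, kernel, ← enorm_neg, neg_sub]

theorem continuous_kernel (R : ℝ) : Continuous fun p : ℂ × ℂ => kernel R p.1 p.2 := by
  unfold kernel
  apply Continuous.ereal_toENNReal
  apply ENNReal.continuous_log.comp
  simp_rw [div_eq_mul_inv]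
  refine (ENNReal.continuous_const_mul ENNReal.ofReal_ne_top).comp ?_
  fun_prop

theorem measurable_kernel (R : ℝ) : Measurable fun p : ℂ × ℂ => kernel R p.1 p.2 :=
  (continuous_kernel R).measurable

theorem continuous_kernel_right (R : ℝ) (z : ℂ) : Continuous (kernel R z) :=
  Continuous.comp (g := fun p : ℂ × ℂ => kernel R p.1 p.2) (f := fun w => (z, w))
    (continuous_kernel R) (by fun_prop)

theorem measurable_kernelPotential (R : ℝ) (μ : Measure ℂ) [SFinite μ] :
    Measurable (kernelPotential R μ) :=
  (measurable_kernel R).lintegral_prod_right'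

theorem neg_logKernel_toENNReal (z w : ℂ) : (-logKernel z w).toENNReal = kernel 1 z w := by
  rw [logKernel, kernel, ← ENNReal.log_inv, ENNReal.ofReal_one, one_div]

theorem logKernel_toENNReal (z w : ℂ) :
    (logKernel z w).toENNReal = ENNReal.ofReal (Real.log ‖z - w‖) := by
  rcases eq_or_ne z w with rfl | h
  · simp [logKernel]
  · have h0 : 0 < ‖z - w‖ := norm_pos_iff.2 (sub_ne_zero.2 h)
    rw [logKernel, ← ofReal_norm, ENNReal.log_ofReal_of_pos h0, EReal.real_coe_toENNReal]

theorem kernel_le_add {R : ℝ} (hR : 1 ≤ R) (z w : ℂ) :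
    kernel R z w ≤ ENNReal.ofReal (Real.log R) + kernel 1 z w := by
  rcases eq_or_ne z w with rfl | h
  · simp [kernel_self one_pos]
  · rw [kernel_of_ne (by linarith) h, kernel_of_ne one_pos h, Real.log_one, zero_sub,
      sub_eq_add_neg]
    exact ENNReal.ofReal_add_le

/-- Written additively, with `log⁺` and `log⁻` on opposite sides, so that no `∞ - ∞` occurs on the
diagonal. -/
theorem kernel_add_log {R : ℝ} (hR : 1 ≤ R) {z w : ℂ} (hzw : ‖z - w‖ ≤ R) :
    kernel R z w + (logKernel z w).toENNReal
      = ENNReal.ofReal (Real.log R) + (-logKernel z w).toENNReal := by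
  rw [neg_logKernel_toENNReal, logKernel_toENNReal]
  rcases eq_or_ne z w with rfl | h
  · simp [kernel_self one_pos, kernel_self (one_pos.trans_le hR)]
  · have h0 : 0 < ‖z - w‖ := norm_pos_iff.2 (sub_ne_zero.2 h)
    rw [kernel_of_ne (by linarith) h, kernel_of_ne one_pos h, Real.log_one, zero_sub]
    have h1 : Real.log ‖z - w‖ ≤ Real.log R := Real.log_le_log h0 hzw
    have h2 : 0 ≤ Real.log R := Real.log_nonneg hR
    rcases le_total 0 (Real.log ‖z - w‖) with h3 | h3
    · rw [← ENNReal.ofReal_add (by linarith) h3,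
        ENNReal.ofReal_of_nonpos (neg_nonpos.2 h3), add_zero]
      congr 1; ring
    · rw [ENNReal.ofReal_of_nonpos h3, add_zero, ← ENNReal.ofReal_add h2 (by linarith)]
      congr 1

/-- For a probability measure on a set of diameter at most `R`, the logarithmic energy is
`log R` minus the energy for `kernel R`. -/
theorem energy_eq {R : ℝ} (hR : 1 ≤ R) {S : Set ℂ} (hS : ∀ z ∈ S, ∀ w ∈ S, ‖z - w‖ ≤ R)
    (μ : Measure ℂ) [IsProbabilityMeasure μ] (hμ : μ Sᶜ = 0) :
    energy μ = (Real.log R : EReal) - (kernelEnergy R μ : EReal) := by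
  have hae : ∀ᵐ z ∂μ, z ∈ S := hμ
  set P := ∫⁻ z, ∫⁻ w, (logKernel z w).toENNReal ∂μ ∂μ with hP
  set N := ∫⁻ z, ∫⁻ w, (-logKernel z w).toENNReal ∂μ ∂μ with hN
  have key : kernelEnergy R μ + P = ENNReal.ofReal (Real.log R) + N := by
    rw [hP, hN, kernelEnergy, ← lintegral_add_left (measurable_kernelPotential R μ)]
    have h2 : ENNReal.ofReal (Real.log R) = ∫⁻ z : ℂ, ENNReal.ofReal (Real.log R) ∂μ := by simp
    rw [h2, ← lintegral_add_left measurable_const]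
    refine lintegral_congr_ae (hae.mono fun z hz => ?_)
    beta_reduce
    rw [kernelPotential, ← lintegral_add_left (continuous_kernel_right R z).measurable]
    have h2 : ENNReal.ofReal (Real.log R) = ∫⁻ z : ℂ, ENNReal.ofReal (Real.log R) ∂μ := by simp
    rw [h2, ← lintegral_add_left measurable_const]
    refine lintegral_congr_ae (hae.mono fun w hw => ?_)
    exact kernel_add_log hR (hS z hz w hw)
  have hPfin : P ≠ ⊤ := by
    refine ne_top_of_le_ne_top (b := ENNReal.ofReal (Real.log R)) ENNReal.ofReal_ne_top ?_
    have h2 : ENNReal.ofReal (Real.log R)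
      = ∫⁻ z : ℂ, ∫⁻ w : ℂ, ENNReal.ofReal (Real.log R) ∂μ ∂μ := by simp
    rw [h2]
    refine lintegral_mono_ae (hae.mono fun z hz => lintegral_mono_ae (hae.mono fun w hw => ?_))
    rw [logKernel_toENNReal]
    rcases eq_or_ne z w with rfl | h
    · simp
    · exact ENNReal.ofReal_le_ofReal
        (Real.log_le_log (norm_pos_iff.2 (sub_ne_zero.2 h)) (hS z hz w hw))
  rw [energy, ← hP, ← hN]
  have hlog : ((ENNReal.ofReal (Real.log R) : ℝ≥0∞) : EReal) = (Real.log R : EReal) := by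
    rw [EReal.coe_ennreal_ofReal, max_eq_left (Real.log_nonneg hR)]
  rcases eq_or_ne N ⊤ with hNt | hNt
  · have : kernelEnergy R μ = ⊤ := by
      by_contra hJ
      rw [hNt] at key
      simp [hJ, hPfin] at key
    rw [hNt, this, EReal.coe_ennreal_top, EReal.sub_top, EReal.sub_top]
  · have hJ : kernelEnergy R μ ≠ ⊤ := by
      intro h
      rw [h, top_add] at key
      exact (ENNReal.add_ne_top.2 ⟨ENNReal.ofReal_ne_top, hNt⟩) key.symm
    clear_value P N
    lift P to NNReal using hPfin
    lift N to NNReal using hNt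
    generalize kernelEnergy R μ = J at *
    lift J to NNReal using hJ
    have h3 : (J : ℝ) + P = Real.log R + N := by
      have := congrArg ENNReal.toReal key
      rwa [ENNReal.toReal_add (by simp) (by simp), ENNReal.toReal_add (by simp) (by simp),
        ENNReal.toReal_ofReal (Real.log_nonneg hR)] at this
    have e : ∀ x : NNReal, (((x : ℝ≥0∞)) : EReal) = ((x : ℝ) : EReal) := fun x => rfl
    rw [e, e, e, ← EReal.coe_sub, ← EReal.coe_sub]
    congr 1; linarith

theorem compactlySupportedIn_iff {K : Set ℂ} (hK : IsCompact K) (μ : Measure ℂ) :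
    CompactlySupportedIn K μ ↔ μ Kᶜ = 0 := by
  constructor
  · rintro ⟨-, h⟩
    exact measure_mono_null (compl_subset_compl.2 h) Measure.measure_compl_support
  · intro h
    have h1 : μ.support ⊆ K := Measure.support_subset_of_isClosed hK.isClosed h
    exact ⟨hK.of_isClosed_subset Measure.isClosed_support h1, h1⟩

theorem exists_diameter_bound {K : Set ℂ} (hK : IsCompact K) :
    ∃ R : ℝ, 1 ≤ R ∧ ∀ z ∈ K, ∀ w ∈ K, ‖z - w‖ ≤ R := by
  obtain ⟨C, hC⟩ := Metric.isBounded_iff.1 hK.isBounded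
  exact ⟨max 1 C, le_max_left _ _, fun z hz w hw =>
    (dist_eq_norm z w).symm.le.trans ((hC hz hw).trans (le_max_right _ _))⟩

/-! ### Existence of equilibrium measures by weak compactness. -/

theorem kernelEnergy_eq_lintegral_prod (R : ℝ) (μ : Measure ℂ) [SFinite μ] :
    kernelEnergy R μ = ∫⁻ p, kernel R p.1 p.2 ∂(μ.prod μ) := by
  rw [lintegral_prod _ (measurable_kernel R).aemeasurable]
  rfl

theorem kernelEnergy_smul (R : ℝ) {c : ℝ≥0∞} (hc : c ≠ ⊤) (μ : Measure ℂ) :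
    kernelEnergy R (c • μ) = c * (c * kernelEnergy R μ) := by
  unfold kernelEnergy kernelPotential
  simp only [lintegral_smul_measure, smul_eq_mul]
  rw [lintegral_const_mul' _ _ hc]

/-- The truncated kernel is bounded and continuous, and `μ ↦ μ × μ` is weakly continuous. The energy
is the supremum of these integrals, hence lower semicontinuous. -/
theorem continuous_lintegral_truncated (R : ℝ) (n : ℕ) :
    Continuous fun μ : ProbabilityMeasure ℂ =>
      ∫⁻ p, min (kernel R p.1 p.2) n ∂((μ : Measure ℂ).prod (μ : Measure ℂ)) := by
  have hc : Continuous fun p : ℂ × ℂ => (min (kernel R p.1 p.2) n).toNNReal := by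
    rw [continuous_iff_continuousAt]
    intro p
    refine ContinuousAt.comp (g := ENNReal.toNNReal) (ENNReal.tendsto_toNNReal ?_)
      ((continuous_kernel R).min continuous_const).continuousAt
    exact ne_top_of_le_ne_top (ENNReal.natCast_ne_top n) (min_le_right _ _)
  let f : BoundedContinuousFunction (ℂ × ℂ) ℝ≥0 :=
    BoundedContinuousFunction.mkOfBound ⟨_, hc⟩ n (by
      intro x y
      have h : ∀ q : ℂ × ℂ, (min (kernel R q.1 q.2) n).toNNReal ≤ (n : ℝ≥0) := fun q => by
        rw [← ENNReal.coe_le_coe, ENNReal.coe_toNNReal]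
        · simp
        · exact ne_top_of_le_ne_top (ENNReal.natCast_ne_top n) (min_le_right _ _)
      have hx : ((min (kernel R x.1 x.2) n).toNNReal : ℝ) ≤ n := by exact_mod_cast h x
      have hy : ((min (kernel R y.1 y.2) n).toNNReal : ℝ) ≤ n := by exact_mod_cast h y
      rw [NNReal.dist_eq, abs_le]
      simp only [ContinuousMap.coe_mk]
      constructor <;> linarith [NNReal.coe_nonneg (min (kernel R x.1 x.2) n).toNNReal,
        NNReal.coe_nonneg (min (kernel R y.1 y.2) n).toNNReal])
  have hf : ∀ p, ((f p : ℝ≥0) : ℝ≥0∞) = min (kernel R p.1 p.2) n := fun p =>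
    ENNReal.coe_toNNReal (ne_top_of_le_ne_top (ENNReal.natCast_ne_top n) (min_le_right _ _))
  have hprod : Continuous fun μ : ProbabilityMeasure ℂ => μ.prod μ :=
    ProbabilityMeasure.continuous_prod.comp (continuous_id.prodMk continuous_id)
  rw [continuous_iff_continuousAt]
  intro μ
  have := (ProbabilityMeasure.tendsto_iff_forall_lintegral_tendsto.1 (hprod.tendsto μ)) f
  simp only [hf, ProbabilityMeasure.toMeasure_prod] at this
  exact this

theorem iSup_min_natCast (x : ℝ≥0∞) : ⨆ n : ℕ, min x n = x := by
  refine le_antisymm (iSup_le fun n => min_le_left _ _) ?_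
  rcases eq_or_ne x ⊤ with rfl | hx
  · simp [ENNReal.iSup_natCast]
  · obtain ⟨n, hn⟩ := ENNReal.exists_nat_gt hx
    exact (le_min le_rfl hn.le).trans (le_iSup (fun n : ℕ => min x n) n)

theorem lowerSemicontinuous_kernelEnergy (R : ℝ) :
    LowerSemicontinuous fun μ : ProbabilityMeasure ℂ => kernelEnergy R (μ : Measure ℂ) := by
  have h : ∀ μ : ProbabilityMeasure ℂ, kernelEnergy R (μ : Measure ℂ)
      = ⨆ n : ℕ, ∫⁻ p, min (kernel R p.1 p.2) n ∂((μ : Measure ℂ).prod (μ : Measure ℂ)) := by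
    intro μ
    rw [kernelEnergy_eq_lintegral_prod, ← lintegral_iSup]
    · simp_rw [iSup_min_natCast]
    · exact fun n => (measurable_kernel R).min measurable_const
    · exact fun m n hmn p => min_le_min_left _ (by exact_mod_cast hmn)
  simp_rw [h]
  exact lowerSemicontinuous_iSup fun n => (continuous_lintegral_truncated R n).lowerSemicontinuous

/-- A non-polar compact set carries a probability measure of finite energy. -/
theorem exists_finite_energy {K : Set ℂ} (hK : ¬ IsPolar K) :
    ∃ μ : Measure ℂ, IsProbabilityMeasure μ ∧ CompactlySupportedIn K μ ∧
      kernelEnergy 1 μ ≠ ⊤ := by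
  unfold IsPolar at hK
  push Not at hK
  obtain ⟨μ, hfin, h0, hc, hI⟩ := hK
  -- In `EReal`, `x - ⊤ = ⊥` even for `x = ⊤`, so energy other than `⊥` already makes the negative
  -- part finite.
  have hN : kernelEnergy 1 μ ≠ ⊤ := by
    intro h
    apply hI
    rw [energy]
    simp_rw [neg_logKernel_toENNReal]
    change _ - (kernelEnergy 1 μ : EReal) = _
    rw [h, EReal.coe_ennreal_top, EReal.sub_top]
  have hm0 : μ univ ≠ 0 := by simpa using h0
  have hmt : μ univ ≠ ⊤ := measure_ne_top μ _
  have hinv : (μ univ)⁻¹ ≠ ⊤ := ENNReal.inv_ne_top.2 hm0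
  have hs : ((μ univ)⁻¹ • μ).support ⊆ μ.support :=
    Measure.AbsolutelyContinuous.support_mono Measure.smul_absolutelyContinuous
  refine ⟨(μ univ)⁻¹ • μ, ⟨?_⟩, ⟨?_, hs.trans hc.2⟩, ?_⟩
  · simp [ENNReal.inv_mul_cancel hm0 hmt]
  · exact hc.1.of_isClosed_subset Measure.isClosed_support hs
  · rw [kernelEnergy_smul _ hinv]
    exact ENNReal.mul_ne_top hinv (ENNReal.mul_ne_top hinv hN)

theorem kernelEnergy_ne_top {R : ℝ} (hR : 1 ≤ R) {μ : Measure ℂ} [IsProbabilityMeasure μ]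
    (h : kernelEnergy 1 μ ≠ ⊤) : kernelEnergy R μ ≠ ⊤ := by
  have : kernelEnergy R μ ≤ ENNReal.ofReal (Real.log R) + kernelEnergy 1 μ := by
    calc kernelEnergy R μ
        ≤ ∫⁻ z, ∫⁻ w, (ENNReal.ofReal (Real.log R) + kernel 1 z w) ∂μ ∂μ :=
          lintegral_mono fun z => lintegral_mono fun w => kernel_le_add hR z w
      _ = ENNReal.ofReal (Real.log R) + kernelEnergy 1 μ := by
          simp_rw [lintegral_add_left measurable_const]
          simp [kernelEnergy, kernelPotential]
  exact ne_top_of_le_ne_top (ENNReal.add_ne_top.2 ⟨ENNReal.ofReal_ne_top, h⟩) this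

/-- A non-polar compact set has an equilibrium measure. -/
theorem exists_isEquilibriumMeasure {K : Set ℂ} (hK : IsCompact K) (hp : ¬ IsPolar K) :
    ∃ μ, IsEquilibriumMeasure K μ := by
  obtain ⟨ν, hν, hνK, -⟩ := exists_finite_energy hp
  obtain ⟨R, hR, hKR⟩ := exists_diameter_bound hK
  -- Prokhorov compactness in tightness form; the sequence of compact sets is constantly `K` with
  -- mass bound `0`, so the index in `ℕ` is a dummy.
  have hcomp : IsCompact {μ : ProbabilityMeasure ℂ | ∀ _ : ℕ, μ Kᶜ ≤ 0} :=
    isCompact_setOfPred_probabilityMeasure_mass_eq_compl_isCompact_le (u := fun _ => 0)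
      (K := fun _ => K) tendsto_const_nhds (fun _ => hK) (Or.inr monotone_const)
  have hmem : ∀ μ : ProbabilityMeasure ℂ,
      (∀ _ : ℕ, μ Kᶜ ≤ 0) ↔ CompactlySupportedIn K (μ : Measure ℂ) := by
    intro μ
    rw [compactlySupportedIn_iff hK, forall_const, nonpos_iff_eq_zero,
      ProbabilityMeasure.null_iff_toMeasure_null]
  have hne : {μ : ProbabilityMeasure ℂ | ∀ _ : ℕ, μ Kᶜ ≤ 0}.Nonempty :=
    ⟨⟨ν, hν⟩, (hmem ⟨ν, hν⟩).2 hνK⟩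
  obtain ⟨μ, hμ, hmin⟩ := ((lowerSemicontinuous_kernelEnergy R).lowerSemicontinuousOn
    {μ : ProbabilityMeasure ℂ | ∀ _ : ℕ, μ Kᶜ ≤ 0}).exists_isMinOn
    hne hcomp
  refine ⟨μ, inferInstance, (hmem μ).1 hμ, fun σ hσ hσK => ?_⟩
  rw [energy_eq hR hKR σ ((compactlySupportedIn_iff hK σ).1 hσK),
    energy_eq hR hKR (μ : Measure ℂ) ((compactlySupportedIn_iff hK _).1 ((hmem μ).1 hμ))]
  refine EReal.sub_le_sub le_rfl (EReal.coe_ennreal_le_coe_ennreal_iff.2 ?_)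
  exact hmin (show (⟨σ, hσ⟩ : ProbabilityMeasure ℂ) ∈ _ from (hmem ⟨σ, hσ⟩).2 hσK)

/-! ### Frostman's theorem on the support. -/

/-- Fatou's lemma for a continuous kernel. It extends an almost everywhere upper bound to the whole
support. -/
theorem isClosed_kernelPotential_le (R : ℝ) (μ : Measure ℂ) (J : ℝ≥0∞) :
    IsClosed {z | kernelPotential R μ z ≤ J} := by
  refine IsSeqClosed.isClosed fun u z hu hz => ?_
  have h1 : ∀ w, kernel R z w = liminf (fun j => kernel R (u j) w) atTop := fun w => by
    refine (Tendsto.liminf_eq ?_).symm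
    simp_rw [kernel_comm R _ w]
    exact ((continuous_kernel_right R w).tendsto z).comp hz
  calc kernelPotential R μ z = ∫⁻ w, liminf (fun j => kernel R (u j) w) atTop ∂μ := by
        simp_rw [kernelPotential, h1]
    _ ≤ liminf (fun j => ∫⁻ w, kernel R (u j) w ∂μ) atTop :=
        lintegral_liminf_le fun j => (continuous_kernel_right R _).measurable
    _ ≤ J := by
        refine liminf_le_of_frequently_le' (Frequently.of_forall fun j => ?_)
        exact hu j

theorem lintegral_kernelPotential_comm (R : ℝ) (μ ν : Measure ℂ) [SFinite μ] [SFinite ν] :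
    ∫⁻ z, kernelPotential R μ z ∂ν = ∫⁻ z, kernelPotential R ν z ∂μ := by
  unfold kernelPotential
  rw [lintegral_lintegral_swap (measurable_kernel R).aemeasurable]
  simp_rw [kernel_comm R]

theorem kernelEnergy_add_smul (R : ℝ) (μ ν : Measure ℂ) [SFinite μ] [SFinite ν] {t : ℝ≥0∞}
    (ht : t ≠ ⊤) :
    kernelEnergy R (μ + t • ν)
      = kernelEnergy R μ + 2 * t * ∫⁻ z, kernelPotential R μ z ∂ν
        + t * (t * kernelEnergy R ν) := by
  have h : ∀ z, kernelPotential R (μ + t • ν) z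
      = kernelPotential R μ z + t * kernelPotential R ν z := fun z => by
    simp [kernelPotential, lintegral_add_measure, lintegral_smul_measure]
  unfold kernelEnergy
  simp_rw [h]
  rw [lintegral_add_measure, lintegral_smul_measure,
    lintegral_add_left (measurable_kernelPotential R μ),
    lintegral_add_left (measurable_kernelPotential R μ), lintegral_const_mul' _ _ ht,
    lintegral_const_mul' _ _ ht, ← lintegral_kernelPotential_comm R μ ν, smul_eq_mul]
  ring

/-- The potential of a minimizer of the energy is almost everywhere at least the energy. -/
theorem ae_kernelEnergy_le_kernelPotential {R : ℝ} {K : Set ℂ} {μ : Measure ℂ}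
    [IsProbabilityMeasure μ] (hμK : μ Kᶜ = 0) (hJ : kernelEnergy R μ ≠ ⊤)
    (hmin : ∀ ν : Measure ℂ, IsProbabilityMeasure ν → ν Kᶜ = 0 →
      kernelEnergy R μ ≤ kernelEnergy R ν) :
    ∀ᵐ z ∂μ, kernelEnergy R μ ≤ kernelPotential R μ z := by
  set J := kernelEnergy R μ with hJdef
  set A := {z | kernelPotential R μ z < J} with hA
  have hAm : MeasurableSet A := measurableSet_lt (measurable_kernelPotential R μ) measurable_const
  by_contra hcon
  have hA0 : μ A ≠ 0 := by
    intro h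
    apply hcon
    rw [ae_iff]
    simpa [not_le] using h
  -- Moving mass to `A`, where the potential is below average, should lower the energy; `μ + t • α`,
  -- normalised, is the competitor.
  set α := μ.restrict A with hα
  set B := ∫⁻ z, kernelPotential R μ z ∂α with hB
  have hBJ : B ≤ J := lintegral_mono' Measure.restrict_le_self le_rfl
  have hBt : B ≠ ⊤ := ne_top_of_le_ne_top hJ hBJ
  have hBlt : B < J * μ A := by
    have := setLIntegral_strict_mono (μ := μ) (f := kernelPotential R μ) (g := fun _ => J) hAm hA0
      measurable_const hBt (Eventually.of_forall fun z hz => hz)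
    simpa using this
  have hαJ : kernelEnergy R α ≤ J :=
    lintegral_mono' Measure.restrict_le_self
      (fun z => lintegral_mono' Measure.restrict_le_self le_rfl)
  have hmt : μ A ≠ ⊤ := measure_ne_top μ A
  have key : ∀ t : ℝ, 0 < t →
      (1 + t * (μ A).toReal) ^ 2 * J.toReal
        ≤ J.toReal + 2 * t * B.toReal + t ^ 2 * J.toReal := by
    intro t ht
    set s : ℝ≥0∞ := ENNReal.ofReal t with hs
    have hst : s ≠ ⊤ := ENNReal.ofReal_ne_top
    set σ := μ + s • α with hσ
    have hσu : σ univ = 1 + s * μ A := by simp [hσ, hα]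
    have hσ0 : σ univ ≠ 0 := by rw [hσu]; simp
    have hσt : σ univ ≠ ⊤ := by
      rw [hσu]; exact ENNReal.add_ne_top.2 ⟨by simp, ENNReal.mul_ne_top hst hmt⟩
    have hinv : (σ univ)⁻¹ ≠ ⊤ := ENNReal.inv_ne_top.2 hσ0
    have h1 := hmin ((σ univ)⁻¹ • σ) ⟨by simp [ENNReal.inv_mul_cancel hσ0 hσt]⟩ (by
      have : α Kᶜ = 0 := le_antisymm ((Measure.restrict_le_self _).trans hμK.le) bot_le
      simp [hσ, hμK, this])
    rw [kernelEnergy_smul _ hinv] at h1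
    have h2 : σ univ * (σ univ * J) ≤ kernelEnergy R σ := by
      calc σ univ * (σ univ * J)
          ≤ σ univ * (σ univ * ((σ univ)⁻¹ * ((σ univ)⁻¹ * kernelEnergy R σ))) := by gcongr
        _ = (σ univ * (σ univ)⁻¹) * ((σ univ * (σ univ)⁻¹) * kernelEnergy R σ) := by ring
        _ = kernelEnergy R σ := by rw [ENNReal.mul_inv_cancel hσ0 hσt, one_mul, one_mul]
    rw [hσu, hσ, kernelEnergy_add_smul R μ α hst] at h2
    have h3 : (1 + s * μ A) * ((1 + s * μ A) * J) ≤ J + 2 * s * B + s * (s * J) :=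
      h2.trans (by gcongr)
    have h4 := ENNReal.toReal_mono (by finiteness) h3
    rw [ENNReal.toReal_add (by finiteness) (by finiteness),
      ENNReal.toReal_add (by finiteness) (by finiteness)] at h4
    simp only [ENNReal.toReal_mul] at h4
    rw [ENNReal.toReal_add (by finiteness) (by finiteness)] at h4
    simp only [ENNReal.toReal_mul, hs, ENNReal.toReal_ofReal ht.le, ENNReal.toReal_one,
      ENNReal.toReal_ofNat] at h4
    nlinarith [h4]
  have hlt : B.toReal < J.toReal * (μ A).toReal := by
    have := (ENNReal.toReal_lt_toReal hBt (by finiteness)).2 hBlt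
    rwa [ENNReal.toReal_mul] at this
  have hJ0 : 0 ≤ J.toReal := ENNReal.toReal_nonneg
  have hd : 0 < J.toReal * (μ A).toReal - B.toReal := sub_pos.2 hlt
  -- With `d = J μ(A) - B > 0`, `key` reduces to `2 d ≤ t J`; the choice `t = d / (J + 1)` makes `t
  -- J < d`, a contradiction.
  have := key ((J.toReal * (μ A).toReal - B.toReal) / (J.toReal + 1)) (by positivity)
  set d := J.toReal * (μ A).toReal - B.toReal with hdd
  set t := d / (J.toReal + 1) with ht
  have ht0 : 0 < t := by positivity
  have htd : t * (J.toReal + 1) = d := by rw [ht]; field_simp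
  have h5 : t * (2 * d) ≤ t * (t * J.toReal) := by
    have : 0 ≤ t ^ 2 * (μ A).toReal ^ 2 * J.toReal := by positivity
    nlinarith
  have h6 := le_of_mul_le_mul_left h5 ht0
  nlinarith

/-- Integrability and lower bound for a logarithmic potential, read off from `kernelPotential`. -/
theorem integrable_log_of_kernelPotential {R : ℝ} (hR : 0 < R) {μ : Measure ℂ}
    [IsProbabilityMeasure μ] {z : ℂ} (hz : ∀ᵐ w ∂μ, ‖z - w‖ ≤ R)
    {J : ℝ≥0∞} (hJ : J ≠ ⊤) (h : kernelPotential R μ z ≤ J) :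
    μ {z} = 0 ∧ Integrable (fun w => Real.log ‖z - w‖) μ ∧
      Real.log R - J.toReal ≤ ∫ w, Real.log ‖z - w‖ ∂μ := by
  have hV : kernelPotential R μ z ≠ ⊤ := ne_top_of_le_ne_top hJ h
  -- An atom at `z` would make the potential infinite, the kernel being `∞` on the diagonal.
  have hz0 : μ {z} = 0 := by
    have h1 := ae_lt_top (continuous_kernel_right R z).measurable hV
    refine measure_mono_null (fun w hw => ?_) h1
    rw [mem_singleton_iff.1 hw]
    simp [kernel_self hR]
  have hne : ∀ᵐ w ∂μ, w ≠ z := by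
    rw [ae_iff]; simpa using hz0
  have heq : kernelPotential R μ z
      = ∫⁻ w, ENNReal.ofReal (Real.log R - Real.log ‖z - w‖) ∂μ :=
    lintegral_congr_ae (hne.mono fun w hw => kernel_of_ne hR hw.symm)
  have hm : Measurable fun w => Real.log R - Real.log ‖z - w‖ := by fun_prop
  have hnn : 0 ≤ᵐ[μ] fun w => Real.log R - Real.log ‖z - w‖ := by
    filter_upwards [hz, hne] with w h1 h2
    exact sub_nonneg.2 (Real.log_le_log (norm_pos_iff.2 (sub_ne_zero.2 h2.symm)) h1)
  have hint : Integrable (fun w => Real.log R - Real.log ‖z - w‖) μ :=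
    (lintegral_ofReal_ne_top_iff_integrable hm.aestronglyMeasurable hnn).1 (heq ▸ hV)
  have hint2 : Integrable (fun w => Real.log ‖z - w‖) μ := by
    refine ((integrable_const (Real.log R)).sub hint).congr (ae_of_all _ fun w => ?_)
    simp
  refine ⟨hz0, hint2, ?_⟩
  have h1 : ∫ w, (Real.log R - Real.log ‖z - w‖) ∂μ = (kernelPotential R μ z).toReal := by
    rw [integral_eq_lintegral_of_nonneg_ae hnn hm.aestronglyMeasurable, heq]
  rw [integral_sub (integrable_const _) hint2] at h1
  have h2 := ENNReal.toReal_mono hJ h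
  simp at h1
  linarith

/-- Maximal logarithmic energy is minimal kernel energy by `energy_eq`; finiteness comes from
comparison with the finite-energy measure that non-polarity provides. -/
theorem IsEquilibriumMeasure.exists_kernelEnergy {K : Set ℂ} (hK : IsCompact K)
    (hp : ¬ IsPolar K) {μ : Measure ℂ} (hμ : IsEquilibriumMeasure K μ) {R : ℝ} (hR : 1 ≤ R)
    (hKR : ∀ z ∈ K, ∀ w ∈ K, ‖z - w‖ ≤ R) :
    kernelEnergy R μ ≠ ⊤ ∧ ∀ ν : Measure ℂ, IsProbabilityMeasure ν → ν Kᶜ = 0 →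
      kernelEnergy R μ ≤ kernelEnergy R ν := by
  obtain ⟨hprob, hsupp, hmax⟩ := hμ
  have hcmp : ∀ ν : Measure ℂ, IsProbabilityMeasure ν → ν Kᶜ = 0 →
      (Real.log R : EReal) - (kernelEnergy R ν : EReal)
        ≤ (Real.log R : EReal) - (kernelEnergy R μ : EReal) := by
    intro ν hν hνK
    rw [← energy_eq hR hKR ν hνK,
      ← energy_eq hR hKR μ ((compactlySupportedIn_iff hK μ).1 hsupp)]
    exact hmax ν hν ((compactlySupportedIn_iff hK ν).2 hνK)
  have e : ∀ x : NNReal, (((x : ℝ≥0∞)) : EReal) = ((x : ℝ) : EReal) := fun x => rfl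
  have hfin : kernelEnergy R μ ≠ ⊤ := by
    obtain ⟨ν, hν, hνK, hν1⟩ := exists_finite_energy hp
    have h1 := kernelEnergy_ne_top hR hν1
    have h2 := hcmp ν hν ((compactlySupportedIn_iff hK ν).1 hνK)
    intro h
    generalize kernelEnergy R ν = J at *
    lift J to ℝ≥0 using h1
    rw [h, EReal.coe_ennreal_top, EReal.sub_top, e, ← EReal.coe_sub, le_bot_iff] at h2
    exact EReal.coe_ne_bot _ h2
  refine ⟨hfin, fun ν hν hνK => ?_⟩
  rcases eq_or_ne (kernelEnergy R ν) ⊤ with h | h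
  · rw [h]; exact le_top
  · have h2 := hcmp ν hν hνK
    generalize kernelEnergy R ν = J at *
    generalize kernelEnergy R μ = J' at *
    lift J to ℝ≥0 using h
    lift J' to ℝ≥0 using hfin
    rw [e, e, ← EReal.coe_sub, ← EReal.coe_sub, EReal.coe_le_coe_iff] at h2
    rw [ENNReal.coe_le_coe, ← NNReal.coe_le_coe]
    linarith

/-- Frostman's theorem on the support: an equilibrium measure of a non-polar compact set has no
atoms, and on its support its potential is at least the (finite) energy. -/
theorem IsEquilibriumMeasure.le_potential_on_support {K : Set ℂ} (hK : IsCompact K)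
    (hp : ¬ IsPolar K) {μ : Measure ℂ} (hμ : IsEquilibriumMeasure K μ) :
    ∃ c : ℝ, energy μ = c ∧ ∀ z ∈ μ.support, μ {z} = 0 ∧
      Integrable (fun w => Real.log ‖z - w‖) μ ∧ c ≤ ∫ w, Real.log ‖z - w‖ ∂μ := by
  obtain ⟨R, hR, hKR⟩ := exists_diameter_bound hK
  obtain ⟨hJ, hmin⟩ := hμ.exists_kernelEnergy hK hp hR hKR
  obtain ⟨hprob, hsupp, hmax⟩ := hμ
  have hμK := (compactlySupportedIn_iff hK μ).1 hsupp
  have hae := ae_kernelEnergy_le_kernelPotential hμK hJ hmin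
  -- The energy is the `μ`-mean of the potential, so the almost everywhere inequality is an
  -- equality.
  have heq : (fun _ => kernelEnergy R μ) =ᵐ[μ] kernelPotential R μ :=
    ae_eq_of_ae_le_of_lintegral_le hae (by simpa using hJ)
      (measurable_kernelPotential R μ).aemeasurable (by simp [kernelEnergy])
  have hV : ∀ z ∈ μ.support, kernelPotential R μ z ≤ kernelEnergy R μ := by
    have hsub : μ.support ⊆ {z | kernelPotential R μ z ≤ kernelEnergy R μ} :=
      Measure.support_subset_of_isClosed (isClosed_kernelPotential_le R μ _)
        (heq.mono fun z hz => hz.symm.le)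
    exact fun z hz => hsub hz
  have haeK : ∀ᵐ w ∂μ, w ∈ K := hμK
  refine ⟨Real.log R - (kernelEnergy R μ).toReal, ?_, fun z hz => ?_⟩
  · rw [energy_eq hR hKR μ hμK, EReal.coe_sub]
    congr 1
    exact (EReal.coe_ennreal_toReal hJ).symm
  · exact integrable_log_of_kernelPotential (one_pos.trans_le hR)
      (haeK.mono fun w hw => hKR z (hsupp.2 hz) w hw) hJ (hV z hz)

/-! ### Minimum principle off the support. -/

/-- The logarithmic potential `∫ log |z - w| dμ(w)`. -/
noncomputable def potential (μ : Measure ℂ) (z : ℂ) : ℝ :=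
  ∫ w, Real.log ‖z - w‖ ∂μ

theorem exists_bound_log_norm_sub {A S : Set ℂ} (hA : IsCompact A) (hS : IsCompact S)
    (hAS : Disjoint A S) : ∃ C : ℝ, ∀ z ∈ A, ∀ w ∈ S, ‖Real.log ‖z - w‖‖ ≤ C := by
  have hc : ContinuousOn (fun p : ℂ × ℂ => Real.log ‖p.1 - p.2‖) (A ×ˢ S) := by
    refine ContinuousOn.log (by fun_prop) fun p hp => ?_
    rw [norm_ne_zero_iff, sub_ne_zero]
    exact hAS.ne_of_mem hp.1 hp.2
  obtain ⟨C, hC⟩ := (hA.prod hS).exists_bound_of_continuousOn hc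
  exact ⟨C, fun z hz w hw => hC (z, w) ⟨hz, hw⟩⟩

section

variable {μ : Measure ℂ} [IsFiniteMeasure μ] {S : Set ℂ}

theorem integrable_log_of_notMem (hS : IsCompact S) (hμ : ∀ᵐ w ∂μ, w ∈ S) {z : ℂ} (hz : z ∉ S) :
    Integrable (fun w => Real.log ‖z - w‖) μ := by
  obtain ⟨C, hC⟩ := exists_bound_log_norm_sub (isCompact_singleton (x := z)) hS
    (disjoint_singleton_left.2 hz)
  exact Integrable.of_bound (by fun_prop : Measurable _).aestronglyMeasurable C
    (hμ.mono fun w hw => hC z rfl w hw)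

theorem continuousAt_potential (hS : IsCompact S) (hμ : ∀ᵐ w ∂μ, w ∈ S) {z : ℂ} (hz : z ∉ S) :
    ContinuousAt (potential μ) z := by
  obtain ⟨ε, hε, hball⟩ := Metric.nhds_basis_closedBall.mem_iff.1
    (hS.isClosed.isOpen_compl.mem_nhds hz)
  obtain ⟨C, hC⟩ := exists_bound_log_norm_sub (isCompact_closedBall z ε) hS
    (disjoint_left.2 fun x hx => hball hx)
  refine continuousAt_of_dominated (bound := fun _ => C)
    (Eventually.of_forall fun x => (by fun_prop : Measurable _).aestronglyMeasurable) ?_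
    (integrable_const C) ?_
  · filter_upwards [Metric.closedBall_mem_nhds z hε] with x hx
    exact hμ.mono fun w hw => hC x hx w hw
  · filter_upwards [hμ] with w hw
    refine ContinuousAt.log (by fun_prop) ?_
    rw [norm_ne_zero_iff, sub_ne_zero]
    rintro rfl
    exact hz hw

/-- The mean value property of logarithmic potentials off the support. -/
theorem circleAverage_potential (hS : IsCompact S) (hμ : ∀ᵐ w ∂μ, w ∈ S) {z : ℂ} {r : ℝ}
    (hr : 0 < r) (hd : Disjoint (Metric.closedBall z r) S) :
    Real.circleAverage (potential μ) z r = potential μ z := by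
  obtain ⟨C, hC⟩ := exists_bound_log_norm_sub (isCompact_closedBall z r) hS hd
  have hmem : ∀ θ, circleMap z r θ ∈ Metric.closedBall z r := fun θ =>
    circleMap_mem_closedBall z hr.le θ
  have hint : Integrable (Function.uncurry fun (θ : ℝ) (w : ℂ) =>
      Real.log ‖circleMap z r θ - w‖) ((volume.restrict (Ioc 0 (2 * Real.pi))).prod μ) := by
    refine Integrable.of_bound (C := C) ?_ ?_
    · refine Measurable.aestronglyMeasurable ?_
      have : Measurable (circleMap z r) := (continuous_circleMap z r).measurable
      unfold Function.uncurry
      fun_prop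
    · have := Measure.quasiMeasurePreserving_snd
        (μ := volume.restrict (Ioc 0 (2 * Real.pi))) (ν := μ) |>.ae hμ
      filter_upwards [this] with p hp
      exact hC _ (hmem p.1) _ hp
  have hpi : (0 : ℝ) ≤ 2 * Real.pi := by positivity
  rw [Real.circleAverage, intervalIntegral.integral_of_le hpi]
  unfold potential
  rw [integral_integral_swap hint, ← integral_smul]
  refine integral_congr_ae (hμ.mono fun w hw => ?_)
  -- The average is `log r + log⁺ (|z - w| / r)`, which is `log |z - w|` because `w` lies outside
  -- the disc.
  have h1 := circleAverage_log_norm_sub_const_eq_log_radius_add_posLog (a := w) (c := z) hr.ne'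
  rw [Real.circleAverage, intervalIntegral.integral_of_le hpi] at h1
  simp only [] at h1 ⊢
  rw [h1]
  have h2 : r < ‖z - w‖ := by
    by_contra hcon
    refine disjoint_left.1 hd ?_ hw
    rw [Metric.mem_closedBall, dist_comm, dist_eq_norm]
    exact not_lt.1 hcon
  have h3 : 1 ≤ |r⁻¹ * ‖z - w‖| := by
    rw [abs_of_pos (mul_pos (inv_pos.2 hr) (hr.trans h2)), ← div_eq_inv_mul, one_le_div hr]
    exact h2.le
  rw [Real.posLog_eq_log h3, Real.log_mul (inv_ne_zero hr.ne') (hr.trans h2).ne', Real.log_inv]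
  ring

/-- The local minimum principle for logarithmic potentials off the support. -/
theorem potential_eq_of_isMin (hS : IsCompact S) (hμ : ∀ᵐ w ∂μ, w ∈ S) {z x : ℂ}
    (hd : Disjoint (Metric.closedBall z ‖x - z‖) S)
    (hmin : ∀ y ∈ Metric.closedBall z ‖x - z‖, potential μ z ≤ potential μ y) :
    potential μ x = potential μ z := by
  rcases eq_or_ne x z with rfl | hne
  · rfl
  set r := ‖x - z‖ with hrdef
  have hr : 0 < r := norm_pos_iff.2 (sub_ne_zero.2 hne)
  have hmem : ∀ θ, circleMap z r θ ∈ Metric.closedBall z r := fun θ =>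
    circleMap_mem_closedBall z hr.le θ
  have hpi : (0 : ℝ) < 2 * Real.pi := by positivity
  have hcont : Continuous fun θ => potential μ (circleMap z r θ) := by
    rw [continuous_iff_continuousAt]
    intro θ
    exact ContinuousAt.comp (f := circleMap z r)
      (continuousAt_potential hS hμ (disjoint_left.1 hd (hmem θ)))
      (continuous_circleMap z r).continuousAt
  obtain ⟨θ, hθ, hxθ⟩ : x ∈ circleMap z r '' Ioc 0 (2 * Real.pi) := by
    rw [image_circleMap_Ioc, abs_of_pos hr, mem_sphere_iff_norm]
  by_contra hcon
  have hlt : potential μ z < potential μ x :=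
    lt_of_le_of_ne (hmin x (by rw [← hxθ]; exact hmem θ)) (Ne.symm hcon)
  have hpos : 0 < ∫ θ in (0 : ℝ)..2 * Real.pi, (potential μ (circleMap z r θ) - potential μ z) := by
    refine intervalIntegral.integral_pos hpi (hcont.sub continuous_const).continuousOn (fun t _ => ?_)
      ⟨θ, Ioc_subset_Icc_self hθ, ?_⟩
    · exact sub_nonneg.2 (hmin _ (hmem t))
    · rw [hxθ]; exact sub_pos.2 hlt
  have havg := circleAverage_potential hS hμ hr hd
  rw [Real.circleAverage, smul_eq_mul, inv_mul_eq_iff_eq_mul₀ hpi.ne'] at havg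
  rw [intervalIntegral.integral_sub (hcont.intervalIntegrable _ _) (by simp), havg] at hpos
  simp at hpos

/-- Compare `z` with a nearest point `ζ` of `S`: `|ζ - w| ≤ |z - w| (1 + dist(z, S) / |z - w|)`.
Integrating the logarithm bounds `U(ζ)` by `U(z)` plus the error term. -/
theorem potential_ge_of_le_support (hS : IsCompact S) (hSn : S.Nonempty) (hμ : ∀ᵐ w ∂μ, w ∈ S)
    {c : ℝ} (hc : ∀ z ∈ S, μ {z} = 0 ∧ Integrable (fun w => Real.log ‖z - w‖) μ ∧
      c ≤ potential μ z) {z : ℂ} (hz : z ∉ S) :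
    c - ∫ w, Real.log (1 + Metric.infDist z S / ‖z - w‖) ∂μ ≤ potential μ z := by
  obtain ⟨ζ, hζ, hdist⟩ := hS.exists_infDist_eq_dist hSn z
  obtain ⟨hζ0, hζi, hζc⟩ := hc ζ hζ
  have hi1 := integrable_log_of_notMem hS hμ hz
  have hi2 : Integrable (fun w => Real.log (1 + Metric.infDist z S / ‖z - w‖)) μ := by
    refine Integrable.of_bound (C := Real.log 2)
      (by fun_prop : Measurable _).aestronglyMeasurable (hμ.mono fun w hw => ?_)
    have h1 : Metric.infDist z S / ‖z - w‖ ≤ 1 :=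
      div_le_one_of_le₀ (by rw [← dist_eq_norm]; exact Metric.infDist_le_dist_of_mem hw)
        (norm_nonneg _)
    have h0 : 0 ≤ Metric.infDist z S / ‖z - w‖ := div_nonneg Metric.infDist_nonneg (norm_nonneg _)
    rw [Real.norm_of_nonneg (Real.log_nonneg (by linarith))]
    exact Real.log_le_log (by linarith) (by linarith)
  have hne : ∀ᵐ w ∂μ, w ≠ ζ := by
    rw [ae_iff]; simpa using hζ0
  rw [sub_le_iff_le_add]
  refine hζc.trans ?_
  unfold potential
  rw [← integral_add hi1 hi2]
  refine integral_mono_ae hζi (hi1.add hi2) ?_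
  filter_upwards [hμ, hne] with w hw hwζ
  have h0 : 0 < ‖z - w‖ := by
    rw [norm_pos_iff, sub_ne_zero]; rintro rfl; exact hz hw
  have h1 : 0 ≤ Metric.infDist z S / ‖z - w‖ := div_nonneg Metric.infDist_nonneg (norm_nonneg _)
  have h2 : (0 : ℝ) < 1 + Metric.infDist z S / ‖z - w‖ := by linarith
  rw [← Real.log_mul h0.ne' h2.ne']
  refine Real.log_le_log (norm_pos_iff.2 (sub_ne_zero.2 hwζ.symm)) ?_
  rw [mul_add, mul_one, mul_div_cancel₀ _ h0.ne', hdist, dist_eq_norm]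
  calc ‖ζ - w‖ = ‖(z - w) - (z - ζ)‖ := by congr 1; ring
    _ ≤ ‖z - w‖ + ‖z - ζ‖ := norm_sub_le _ _

/-- Dominated convergence: `dist(z, S) ≤ |z - w|` bounds the integrand by `log 2`, and it tends to
`0` for `w ≠ ζ`. -/
theorem tendsto_integral_log_one_add_infDist (hμ : ∀ᵐ w ∂μ, w ∈ S) {ζ : ℂ} (hζ : ζ ∈ S)
    (hζ0 : μ {ζ} = 0) :
    Tendsto (fun z => ∫ w, Real.log (1 + Metric.infDist z S / ‖z - w‖) ∂μ) (𝓝 ζ) (𝓝 0) := by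
  have hne : ∀ᵐ w ∂μ, w ≠ ζ := by
    rw [ae_iff]; simpa using hζ0
  have h := tendsto_integral_filter_of_dominated_convergence (μ := μ) (l := 𝓝 ζ)
    (F := fun z w => Real.log (1 + Metric.infDist z S / ‖z - w‖)) (f := fun _ => 0)
    (fun _ => Real.log 2)
    (Eventually.of_forall fun z => (by fun_prop : Measurable _).aestronglyMeasurable)
    (Eventually.of_forall fun z => hμ.mono fun w hw => ?_) (integrable_const _) ?_
  · simpa using h
  · have h1 : Metric.infDist z S / ‖z - w‖ ≤ 1 :=
      div_le_one_of_le₀ (by rw [← dist_eq_norm]; exact Metric.infDist_le_dist_of_mem hw)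
        (norm_nonneg _)
    have h0 : 0 ≤ Metric.infDist z S / ‖z - w‖ := div_nonneg Metric.infDist_nonneg (norm_nonneg _)
    rw [Real.norm_of_nonneg (Real.log_nonneg (by linarith))]
    exact Real.log_le_log (by linarith) (by linarith)
  · filter_upwards [hne] with w hw
    have h0 : ‖ζ - w‖ ≠ 0 := norm_ne_zero_iff.2 (sub_ne_zero.2 hw.symm)
    have hc : ContinuousAt (fun z => Real.log (1 + Metric.infDist z S / ‖z - w‖)) ζ := by
      refine ContinuousAt.log (continuousAt_const.add (ContinuousAt.div ?_ (by fun_prop) h0)) ?_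
      · exact (Metric.continuous_infDist_pt S).continuousAt
      · simp [Metric.infDist_zero_of_mem hζ]
    have := hc.tendsto
    simpa [Metric.infDist_zero_of_mem hζ] using this

open Classical in
/-- The minimum principle: a lower bound for a logarithmic potential on a compact set carrying the
measure holds everywhere. -/
theorem le_potential_of_le_on_support [IsProbabilityMeasure μ] (hS : IsCompact S)
    (hμ : ∀ᵐ w ∂μ, w ∈ S)
    {c : ℝ} (hc : ∀ z ∈ S, μ {z} = 0 ∧ Integrable (fun w => Real.log ‖z - w‖) μ ∧
      c ≤ potential μ z) (z : ℂ) :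
    c ≤ potential μ z := by
  have hSn : S.Nonempty := by
    obtain ⟨w, hw⟩ := hμ.exists
    exact ⟨w, hw⟩
  -- The potential itself need not be continuous on `S`; this glued function is, squeezed between
  -- `c` minus the error term and `c`.
  set h : ℂ → ℝ := fun z => if z ∈ S then c else min (potential μ z) c with hh
  have hin : ∀ z ∈ S, h z = c := fun z hz => if_pos hz
  have hout : ∀ z ∉ S, h z = min (potential μ z) c := fun z hz => if_neg hz
  have hle : ∀ z, h z ≤ c := fun z => by
    by_cases hz : z ∈ S
    · exact (hin z hz).le
    · rw [hout z hz]; exact min_le_right _ _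
  have hge : ∀ z, c - ∫ w, Real.log (1 + Metric.infDist z S / ‖z - w‖) ∂μ ≤ h z := by
    intro z
    by_cases hz : z ∈ S
    · rw [hin z hz]; simp [Metric.infDist_zero_of_mem hz]
    · rw [hout z hz, le_min_iff]
      refine ⟨potential_ge_of_le_support hS hSn hμ hc hz, sub_le_self _ ?_⟩
      exact integral_nonneg fun w => Real.log_nonneg (by
        have : 0 ≤ Metric.infDist z S / ‖z - w‖ := div_nonneg Metric.infDist_nonneg (norm_nonneg _)
        linarith)
  have hcont : Continuous h := by
    rw [continuous_iff_continuousAt]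
    intro x
    by_cases hx : x ∈ S
    · rw [ContinuousAt, hin x hx]
      refine tendsto_of_tendsto_of_tendsto_of_le_of_le ?_ tendsto_const_nhds hge hle
      simpa using (tendsto_const_nhds (x := c)).sub
        (tendsto_integral_log_one_add_infDist hμ hx (hc x hx).1)
    · have : h =ᶠ[𝓝 x] fun z => min (potential μ z) c := by
        filter_upwards [hS.isClosed.isOpen_compl.mem_nhds hx] with y hy
        exact hout y hy
      refine ContinuousAt.congr ?_ this.symm
      exact Filter.Tendsto.min (continuousAt_potential hS hμ hx) continuousAt_const
  suffices hall : ∀ x, h x = c by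
    by_cases hz : z ∈ S
    · exact (hc z hz).2.2
    · have := hall z
      rw [hout z hz] at this
      exact min_eq_right_iff.1 this
  by_contra hcon
  push Not at hcon
  obtain ⟨x₀, hx₀⟩ := hcon
  have hx₀ : h x₀ < c := lt_of_le_of_ne (hle x₀) hx₀
  obtain ⟨M, hM⟩ := hS.isBounded.exists_norm_le
  have hfar : ∀ x, M + Real.exp c < ‖x‖ → h x = c := by
    intro x hx
    by_cases hxS : x ∈ S
    · exact hin x hxS
    · rw [hout x hxS, min_eq_right_iff]
      have : ∫ _ : ℂ, c ∂μ ≤ potential μ x := by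
        refine integral_mono_ae (integrable_const c) (integrable_log_of_notMem hS hμ hxS)
          (hμ.mono fun w hw => ?_)
        have h1 : Real.exp c ≤ ‖x - w‖ := by
          have := norm_sub_norm_le x w
          have := hM w hw
          linarith
        exact (Real.le_log_iff_exp_le ((Real.exp_pos c).trans_le h1)).2 h1
      simpa using this
  -- Outside this ball `h = c` is the upper bound, so a minimum on the ball is global; the radius
  -- includes `‖x₀‖` to keep `x₀` inside.
  obtain ⟨x₁, -, hx₁⟩ := (isCompact_closedBall (0 : ℂ) (max (M + Real.exp c) ‖x₀‖)).exists_isMinOn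
    ⟨x₀, by simp⟩ hcont.continuousOn
  have hglob : ∀ x, h x₁ ≤ h x := by
    intro x
    by_cases hx : x ∈ Metric.closedBall (0 : ℂ) (max (M + Real.exp c) ‖x₀‖)
    · exact hx₁ hx
    · rw [mem_closedBall_zero_iff, not_le, max_lt_iff] at hx
      rw [hfar x hx.1]
      exact hle x₁
  have hm : h x₁ < c := (hglob x₀).trans_lt hx₀
  have hnS : ∀ x, h x = h x₁ → x ∉ S ∧ potential μ x = h x₁ := by
    intro x hx
    have hxS : x ∉ S := fun hxS => by rw [hin x hxS] at hx; linarith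
    refine ⟨hxS, ?_⟩
    rw [hout x hxS] at hx
    rcases min_choice (potential μ x) c with h1 | h1
    · rw [← hx, h1]
    · rw [h1] at hx; linarith
  -- Minimum points lie off `S`, where the local minimum principle makes their set open.
  -- Connectedness of `ℂ` makes it everything, including `S`, where `h = c`.
  have hclopen : IsClopen {x | h x = h x₁} := by
    refine ⟨isClosed_eq hcont continuous_const, Metric.isOpen_iff.2 fun x hx => ?_⟩
    obtain ⟨hxS, hxm⟩ := hnS x hx
    obtain ⟨ε, hε, hball⟩ := Metric.isOpen_iff.1 hS.isClosed.isOpen_compl x hxS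
    refine ⟨ε, hε, fun y hy => ?_⟩
    have hsub : Metric.closedBall x ‖y - x‖ ⊆ Sᶜ :=
      (Metric.closedBall_subset_ball (by rwa [← dist_eq_norm])).trans hball
    have hU : ∀ v ∈ Metric.closedBall x ‖y - x‖, potential μ x ≤ potential μ v := by
      intro v hv
      rw [hxm]
      refine (hglob v).trans ?_
      rw [hout v (hsub hv)]
      exact min_le_left _ _
    have := potential_eq_of_isMin hS hμ (disjoint_left.2 fun v hv => hsub hv) hU
    rw [mem_ofPred_eq, hout y (hball hy), this, hxm]
    exact min_eq_left hm.le
  have huniv := hclopen.eq_univ ⟨x₁, rfl⟩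
  obtain ⟨s, hs⟩ := hSn
  have : s ∈ {x | h x = h x₁} := by rw [huniv]; exact mem_univ s
  rw [mem_ofPred_eq, hin s hs] at this
  linarith

end

/-- Frostman's theorem: the potential of an equilibrium measure is everywhere at least its
energy. -/
theorem IsEquilibriumMeasure.le_potential {K : Set ℂ} (hK : IsCompact K)
    (hp : ¬ IsPolar K) {μ : Measure ℂ} (hμ : IsEquilibriumMeasure K μ) :
    ∃ c : ℝ, energy μ = c ∧ ∀ z, μ {z} = 0 ∧
      Integrable (fun w => Real.log ‖z - w‖) μ ∧ c ≤ potential μ z := by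
  obtain ⟨c, hc, h⟩ := hμ.le_potential_on_support hK hp
  have := hμ.1
  have hS : IsCompact μ.support := hμ.2.1.1
  have hae : ∀ᵐ w ∂μ, w ∈ μ.support := Measure.support_mem_ae
  refine ⟨c, hc, fun z => ?_⟩
  by_cases hz : z ∈ μ.support
  · exact h z hz
  · refine ⟨?_, integrable_log_of_notMem hS hae hz, le_potential_of_le_on_support hS hae h z⟩
    exact measure_mono_null (singleton_subset_iff.2 hz) Measure.measure_compl_support

/-! ### Minimal polynomials and the Jensen bound. -/

theorem memLp_eval {μ : Measure ℂ} [IsFiniteMeasure μ] (hμ : IsCompact μ.support) (P : ℂ[X])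
    (p : ℝ≥0∞) : MemLp (fun z => P.eval z) p μ := by
  obtain ⟨C, hC⟩ := hμ.exists_bound_of_continuousOn P.continuous.continuousOn
  have hae : ∀ᵐ w ∂μ, w ∈ μ.support := Measure.support_mem_ae
  exact MemLp.of_bound P.continuous.measurable.aestronglyMeasurable C (hae.mono fun w hw => hC w hw)

/-- Monic polynomials of minimal `L²`-norm exist for every finite compactly supported measure. -/
theorem exists_isMonicMinimizer {μ : Measure ℂ} [IsFiniteMeasure μ] (hμ : IsCompact μ.support)
    (n : ℕ) : ∃ P, IsMonicMinimizer n μ P := by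
  let L : ℂ[X] →ₗ[ℂ] Lp ℂ 2 μ :=
    { toFun := fun P => (memLp_eval hμ P 2).toLp
      map_add' := fun P Q => by
        rw [← MemLp.toLp_add]
        congr 1
        ext z
        simp
      map_smul' := fun a P => by
        rw [RingHom.id_apply, ← MemLp.toLp_const_smul]
        congr 1
        ext z
        simp }
  have hnorm : ∀ P, polyNorm P μ = ENNReal.ofReal ‖L P‖ := fun P => by
    change eLpNorm _ 2 μ = ENNReal.ofReal ‖(memLp_eval hμ P 2).toLp‖
    rw [Lp.norm_toLp, ENNReal.ofReal_toReal (memLp_eval hμ P 2).eLpNorm_ne_top]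
  -- The minimizer is `X ^ n` minus its projection to this finite-dimensional space; `L` need not be
  -- injective.
  let V : Submodule ℂ (Lp ℂ 2 μ) := (degreeLT ℂ n).map L
  have : FiniteDimensional ℂ (degreeLT ℂ n) := Module.Finite.of_basis (degreeLT.basis ℂ n)
  have : FiniteDimensional ℂ V := inferInstance
  obtain ⟨v, ⟨q, hq, rfl⟩, hv⟩ := Submodule.exists_norm_eq_iInf_of_complete_subspace (𝕜 := ℂ) V
    V.complete_of_finiteDimensional (L (X ^ n))
  have hqd : q.degree < n := mem_degreeLT.1 hq
  have hmonic : (X ^ n - q).Monic := monic_X_pow_sub hqd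
  have hdeg : (X ^ n - q : ℂ[X]).natDegree = n := by
    refine natDegree_eq_of_degree_eq_some ?_
    rw [degree_sub_eq_left_of_degree_lt (by rwa [degree_X_pow]), degree_X_pow]
  refine ⟨X ^ n - q, hmonic, hdeg, fun Q hQ hQn => ?_⟩
  rw [hnorm, hnorm]
  refine ENNReal.ofReal_le_ofReal ?_
  have hdQ : (X ^ n - Q : ℂ[X]).degree < n := by
    have hQd : Q.degree = n := by rw [degree_eq_natDegree hQ.ne_zero, hQn]
    have := degree_sub_lt_left (p := (X ^ n : ℂ[X])) (q := Q) (by rw [degree_X_pow, hQd])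
      (pow_ne_zero _ X_ne_zero) (by rw [hQ.leadingCoeff, (monic_X_pow n).leadingCoeff])
    rwa [degree_X_pow] at this
  have hmem : L (X ^ n - Q) ∈ V := ⟨_, mem_degreeLT.2 hdQ, rfl⟩
  rw [map_sub, hv]
  refine (ciInf_le ⟨0, ?_⟩ (⟨_, hmem⟩ : V)).trans (le_of_eq ?_)
  · rintro _ ⟨w, rfl⟩
    exact norm_nonneg _
  · simp

theorem isMonicMinimizer_orthoPoly {μ : Measure ℂ} [IsFiniteMeasure μ]
    (hμ : IsCompact μ.support) (n : ℕ) : IsMonicMinimizer n μ (orthoPoly n μ) := by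
  have h := exists_isMonicMinimizer hμ n
  rw [orthoPoly, dif_pos h]
  exact h.choose_spec

section

variable {μ : Measure ℂ} {c : ℝ}

/-- Adds the potentials at the roots, with multiplicity. Here `f` plays `log |P|`; the roots are
null since `μ` has no atoms. -/
theorem log_prod_roots [IsFiniteMeasure μ] (h : ∀ z, μ {z} = 0 ∧
    Integrable (fun w => Real.log ‖z - w‖) μ ∧ c ≤ potential μ z) (s : Multiset ℂ) :
    ∃ f : ℂ → ℝ, Integrable f μ ∧ s.card * c ≤ ∫ w, f w ∂μ ∧
      ∀ᵐ w ∂μ, Real.exp (f w) = ‖((s.map fun a => X - C a).prod).eval w‖ := by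
  induction s using Multiset.induction_on with
  | empty => exact ⟨fun _ => 0, integrable_zero _ _ _, by simp, by simp⟩
  | cons a s ih =>
    obtain ⟨f, hf, hfc, hfe⟩ := ih
    obtain ⟨ha0, hai, hac⟩ := h a
    refine ⟨fun w => Real.log ‖a - w‖ + f w, hai.add hf, ?_, ?_⟩
    · rw [integral_add hai hf, Multiset.card_cons]
      push_cast
      have : c ≤ ∫ w, Real.log ‖a - w‖ ∂μ := hac
      linarith
    · have hne : ∀ᵐ w ∂μ, w ≠ a := by
        rw [ae_iff]; simpa using ha0
      filter_upwards [hfe, hne] with w hw hwa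
      rw [Real.exp_add, hw, Real.exp_log (norm_pos_iff.2 (sub_ne_zero.2 hwa.symm)),
        Multiset.map_cons, Multiset.prod_cons, eval_mul, norm_mul]
      simp [norm_sub_rev]

/-- A lower bound `c` for the logarithmic potential gives the lower bound `exp c ^ n` for the
`L²`-norm of monic polynomials of degree `n`. -/
theorem exp_pow_le_polyNorm [IsProbabilityMeasure μ] (hμ : IsCompact μ.support)
    (h : ∀ z, μ {z} = 0 ∧ Integrable (fun w => Real.log ‖z - w‖) μ ∧ c ≤ potential μ z)
    {P : ℂ[X]} (hP : P.Monic) :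
    ENNReal.ofReal (Real.exp c) ^ P.natDegree ≤ polyNorm P μ := by
  obtain ⟨f, hf, hfc, hfe⟩ := log_prod_roots h P.roots
  have hsplit := IsAlgClosed.splits P
  rw [← hsplit.eq_prod_roots_of_monic hP] at hfe
  rw [← hsplit.natDegree_eq_card_roots] at hfc
  have hPi : Integrable (fun z => P.eval z) μ := memLp_one_iff_integrable.1 (memLp_eval hμ P 1)
  have hexp : Integrable (fun w => Real.exp (f w)) μ :=
    hPi.norm.congr (hfe.mono fun w hw => hw.symm)
  have hJ := convexOn_exp.map_integral_le (μ := μ) (f := f) Real.continuous_exp.continuousOn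
    isClosed_univ (by simp) hf hexp
  calc ENNReal.ofReal (Real.exp c) ^ P.natDegree
      = ENNReal.ofReal (Real.exp (P.natDegree * c)) := by
        rw [← ENNReal.ofReal_pow (Real.exp_pos c).le, ← Real.exp_nat_mul]
    _ ≤ ENNReal.ofReal (∫ w, ‖P.eval w‖ ∂μ) := by
        refine ENNReal.ofReal_le_ofReal ((Real.exp_le_exp.2 hfc).trans (hJ.trans (le_of_eq ?_)))
        exact integral_congr_ae hfe
    _ = eLpNorm (fun z => P.eval z) 1 μ := by
        rw [ofReal_integral_norm_eq_lintegral_enorm hPi, eLpNorm_one_eq_lintegral_enorm]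
    _ ≤ polyNorm P μ :=
        eLpNorm_le_eLpNorm_of_exponent_le (by norm_num) hPi.aestronglyMeasurable

end

/-! ### Capacity and Widom factors of equilibrium measures. -/

theorem isEquilibriumMeasure_equilibriumMeasure {K : Set ℂ} (hK : IsCompact K)
    (hp : ¬ IsPolar K) : IsEquilibriumMeasure K (equilibriumMeasure K) := by
  have h := exists_isEquilibriumMeasure hK hp
  rw [equilibriumMeasure, dif_pos h]
  exact h.choose_spec

theorem IsEquilibriumMeasure.capacity_eq {K : Set ℂ} {μ : Measure ℂ}
    (hμ : IsEquilibriumMeasure K μ) : capacity K = EReal.exp (energy μ) := by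
  refine le_antisymm ?_ ?_
  · exact iSup_le fun ν => iSup_le fun h1 => iSup_le fun h2 =>
      EReal.exp_monotone (hμ.2.2 ν h1 h2)
  · exact le_iSup_of_le μ (le_iSup_of_le hμ.1 (le_iSup_of_le hμ.2.1 le_rfl))

/-- Competitors on the support also compete on `K`. This identifies the normalising capacity of the
Widom factor with `capacity K`. -/
theorem IsEquilibriumMeasure.support {K : Set ℂ} {μ : Measure ℂ}
    (hμ : IsEquilibriumMeasure K μ) : IsEquilibriumMeasure μ.support μ :=
  ⟨hμ.1, ⟨hμ.2.1.1, subset_rfl⟩, fun ν h1 h2 => hμ.2.2 ν h1 ⟨h2.1, h2.2.trans hμ.2.1.2⟩⟩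

theorem IsEquilibriumMeasure.capacity_pow_le {K : Set ℂ} (hK : IsCompact K) (hp : ¬ IsPolar K)
    {μ : Measure ℂ} (hμ : IsEquilibriumMeasure K μ) (n : ℕ) :
    capacity K ^ n ≤ polyNorm (orthoPoly n μ) μ := by
  obtain ⟨c, hc, h⟩ := hμ.le_potential hK hp
  have := hμ.1
  obtain ⟨h1, h2, -⟩ := isMonicMinimizer_orthoPoly hμ.2.1.1 n
  have h3 := exp_pow_le_polyNorm hμ.2.1.1 h h1
  rwa [h2, ← EReal.exp_coe, ← hc, ← hμ.capacity_eq] at h3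

theorem IsEquilibriumMeasure.one_le_widomFactor {K : Set ℂ} (hK : IsCompact K)
    (hp : ¬ IsPolar K) {μ : Measure ℂ} (hμ : IsEquilibriumMeasure K μ) (n : ℕ) :
    1 ≤ widomFactor n μ := by
  obtain ⟨c, hc, -⟩ := hμ.le_potential hK hp
  have hcap : capacity K = ENNReal.ofReal (Real.exp c) := by
    rw [hμ.capacity_eq, hc, EReal.exp_coe]
  rw [widomFactor, hμ.support.capacity_eq, ← hμ.capacity_eq, ENNReal.le_div_iff_mul_le, one_mul]
  · exact hμ.capacity_pow_le hK hp n
  · left; rw [hcap]; exact pow_ne_zero _ (by simpa using Real.exp_pos c)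
  · left; rw [hcap]; exact ENNReal.pow_ne_top ENNReal.ofReal_ne_top

/-! ### Arc length and equilibrium on the unit circle. -/

theorem arcMeasure_eq : arcMeasure = ENNReal.ofReal (1 / (2 * Real.pi)) •
    (volume.restrict (Ioc (0 : ℝ) (2 * Real.pi))).map (circleMap 0 1) := by
  have : (fun θ : ℝ => Complex.exp (θ * Complex.I)) = circleMap 0 1 := by
    ext θ; simp [circleMap]
  rw [arcMeasure, this, Measure.restrict_congr_set Ico_ae_eq_Ioc]

theorem measurable_circleMap : Measurable (circleMap 0 1) :=
  (continuous_circleMap 0 1).measurable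

theorem isProbabilityMeasure_arcMeasure : IsProbabilityMeasure arcMeasure := by
  constructor
  rw [arcMeasure_eq, Measure.smul_apply, Measure.map_apply measurable_circleMap MeasurableSet.univ,
    preimage_univ, Measure.restrict_apply_univ, Real.volume_Ioc, smul_eq_mul,
    ← ENNReal.ofReal_mul (by positivity), sub_zero,
    one_div_mul_cancel (by positivity), ENNReal.ofReal_one]

theorem arcMeasure_compl_sphere : arcMeasure (Metric.sphere (0 : ℂ) 1)ᶜ = 0 := by
  rw [arcMeasure_eq, Measure.smul_apply, Measure.map_apply measurable_circleMap
    Metric.isClosed_sphere.measurableSet.compl]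
  have : circleMap 0 1 ⁻¹' (Metric.sphere (0 : ℂ) 1)ᶜ = ∅ := by
    ext θ; simp
  rw [this, measure_empty, smul_zero]

theorem arcMeasure_singleton (z : ℂ) : arcMeasure {z} = 0 := by
  rw [arcMeasure_eq, Measure.smul_apply, Measure.map_apply measurable_circleMap
    (measurableSet_singleton z)]
  have : (circleMap 0 1 ⁻¹' {z}).Countable :=
    (countable_singleton z).preimage_circleMap 0 one_ne_zero
  rw [this.measure_zero, smul_zero]

theorem integral_arcMeasure {f : ℂ → ℝ} (hf : Measurable f) :
    ∫ z, f z ∂arcMeasure = Real.circleAverage f 0 1 := by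
  rw [arcMeasure_eq, integral_smul_measure,
    integral_map measurable_circleMap.aemeasurable hf.aestronglyMeasurable, Real.circleAverage,
    intervalIntegral.integral_of_le (by positivity), ENNReal.toReal_ofReal (by positivity), one_div]

theorem integrable_arcMeasure {f : ℂ → ℝ} (hf : Measurable f) (h : CircleIntegrable f 0 1) :
    Integrable f arcMeasure := by
  rw [arcMeasure_eq]
  refine Integrable.smul_measure ?_ ENNReal.ofReal_ne_top
  rw [integrable_map_measure hf.aestronglyMeasurable measurable_circleMap.aemeasurable]
  exact (intervalIntegrable_iff_integrableOn_Ioc_of_le (by positivity)).1 h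

theorem sphere_diameter_bound : ∀ z ∈ Metric.sphere (0 : ℂ) 1, ∀ w ∈ Metric.sphere (0 : ℂ) 1,
    ‖z - w‖ ≤ 2 := fun z hz w hw => by
  rw [mem_sphere_zero_iff_norm] at hz hw
  linarith [norm_sub_le z w]

/-- The circle average of `log |w - z|` vanishes for `|z| = 1`, so the potential for `R = 2`, the
diameter, is constantly `log 2`. -/
theorem energy_arcMeasure : energy arcMeasure = 0 := by
  have := isProbabilityMeasure_arcMeasure
  have hae : ∀ᵐ z ∂arcMeasure, z ∈ Metric.sphere (0 : ℂ) 1 := arcMeasure_compl_sphere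
  have hV : ∀ z ∈ Metric.sphere (0 : ℂ) 1,
      kernelPotential 2 arcMeasure z = ENNReal.ofReal (Real.log 2) := by
    intro z hz
    have hne : ∀ᵐ w ∂arcMeasure, w ≠ z := by
      rw [ae_iff]; simpa using arcMeasure_singleton z
    have hm : Measurable fun w => Real.log ‖w - z‖ := by fun_prop
    have hi : Integrable (fun w => Real.log ‖w - z‖) arcMeasure :=
      integrable_arcMeasure hm (circleIntegrable_log_norm_sub_const 1)
    have h0 : ∫ w, Real.log ‖w - z‖ ∂arcMeasure = 0 := by
      rw [integral_arcMeasure hm]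
      exact circleAverage_log_norm_sub_const₁ (mem_sphere_zero_iff_norm.1 hz)
    have h1 : kernelPotential 2 arcMeasure z
        = ∫⁻ w, ENNReal.ofReal (Real.log 2 - Real.log ‖w - z‖) ∂arcMeasure :=
      lintegral_congr_ae (hne.mono fun w hw => by
        beta_reduce
        rw [kernel_of_ne two_pos hw.symm, norm_sub_rev])
    rw [h1, ← ofReal_integral_eq_lintegral_ofReal (f := fun w => Real.log 2 - Real.log ‖w - z‖)
      ((integrable_const _).sub hi), integral_sub (integrable_const _) hi, h0]
    · simp
    · filter_upwards [hae, hne] with w hw hwz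
      exact sub_nonneg.2 (Real.log_le_log (norm_pos_iff.2 (sub_ne_zero.2 hwz))
        (sphere_diameter_bound w hw z hz))
  have hE : kernelEnergy 2 arcMeasure = ENNReal.ofReal (Real.log 2) := by
    rw [kernelEnergy, lintegral_congr_ae (hae.mono fun z hz => hV z hz)]
    simp
  rw [energy_eq one_le_two sphere_diameter_bound arcMeasure arcMeasure_compl_sphere, hE,
    EReal.coe_ennreal_ofReal, max_eq_left (Real.log_nonneg one_le_two), ← EReal.coe_sub, sub_self,
    EReal.coe_zero]

theorem compactlySupportedIn_arcMeasure :
    CompactlySupportedIn (Metric.sphere (0 : ℂ) 1) arcMeasure :=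
  (compactlySupportedIn_iff (isCompact_sphere 0 1) _).2 arcMeasure_compl_sphere

theorem not_isPolar_sphere : ¬ IsPolar (Metric.sphere (0 : ℂ) 1) := by
  have := isProbabilityMeasure_arcMeasure
  intro h
  have := h arcMeasure inferInstance (IsProbabilityMeasure.ne_zero _)
    compactlySupportedIn_arcMeasure
  rw [energy_arcMeasure] at this
  exact EReal.zero_ne_bot this

/-- Arc length as competitor gives `c ≥ 0`, and `U(0) = 0` gives `c ≤ 0`. Then `U ≥ 0` attains its
minimum at the centre, hence vanishes in the disc. -/
theorem IsEquilibriumMeasure.energy_sphere {μ : Measure ℂ}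
    (hμ : IsEquilibriumMeasure (Metric.sphere (0 : ℂ) 1) μ) :
    energy μ = 0 ∧ ∀ z, ‖z‖ < 1 → potential μ z = 0 := by
  obtain ⟨c, hc, h⟩ := hμ.le_potential (isCompact_sphere 0 1) not_isPolar_sphere
  have := hμ.1
  have hae : ∀ᵐ w ∂μ, w ∈ Metric.sphere (0 : ℂ) 1 :=
    (compactlySupportedIn_iff (isCompact_sphere 0 1) μ).1 hμ.2.1
  have h0 : potential μ 0 = 0 := by
    rw [potential, ← integral_zero ℂ ℝ (μ := μ)]
    refine integral_congr_ae (hae.mono fun w hw => ?_)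
    beta_reduce
    rw [zero_sub, norm_neg, mem_sphere_zero_iff_norm.1 hw, Real.log_one]
  have hc0 : 0 ≤ c := by
    have := hμ.2.2 arcMeasure isProbabilityMeasure_arcMeasure compactlySupportedIn_arcMeasure
    rw [energy_arcMeasure, hc] at this
    exact_mod_cast this
  have hc1 : c = 0 := le_antisymm (h0 ▸ (h 0).2.2) hc0
  refine ⟨by rw [hc, hc1, EReal.coe_zero], fun z hz => ?_⟩
  rw [← h0]
  refine potential_eq_of_isMin (isCompact_sphere (0 : ℂ) 1) hae ?_ fun y _ => ?_
  · rw [sub_zero]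
    refine disjoint_left.2 fun y hy hy' => ?_
    rw [mem_closedBall_zero_iff] at hy
    rw [mem_sphere_zero_iff_norm] at hy'
    linarith
  · rw [h0]; exact hc0.trans (h y).2.2

/-! ### Uniqueness on the circle through moments. -/

/-- If the logarithmic potential of a measure on the unit circle vanishes in the unit disc, then
all moments of positive order vanish. -/
theorem integral_pow_eq_zero {μ : Measure ℂ} [IsProbabilityMeasure μ]
    (hae : ∀ᵐ w ∂μ, ‖w‖ = 1) (h : ∀ z, ‖z‖ < 1 → potential μ z = 0) {n : ℕ} (hn : n ≠ 0) :
    ∫ w, w ^ n ∂μ = 0 := by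
  -- An `n`-th root of the moment `m`, so that the coefficient `a n` below equals `|m|² / n`.
  obtain ⟨z, hz⟩ := IsAlgClosed.exists_pow_nat_eq (∫ w, w ^ n ∂μ) (Nat.pos_of_ne_zero hn)
  have hint : ∀ (k : ℕ) (a : ℂ), Integrable (fun w => (a * (starRingEnd ℂ) w) ^ k / k) μ := by
    intro k a
    refine Integrable.of_bound (C := ‖a‖ ^ k / k)
      (by fun_prop : Continuous _).measurable.aestronglyMeasurable (hae.mono fun w hw => ?_)
    rw [norm_div, norm_pow, norm_mul, RCLike.norm_conj, hw, mul_one, Complex.norm_natCast]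
  set a : ℕ → ℝ := fun k => ∫ w, ((z * (starRingEnd ℂ) w) ^ k / k).re ∂μ with ha
  -- The series is `-U(r z)`, by `|r z - w| = |1 - r z w̄|` on the circle and the Taylor series of
  -- the logarithm. The term `k = 0` is `0` because division by zero gives `0`.
  have hsum : ∀ r : ℝ, |r| * ‖z‖ < 1 → HasSum (fun k : ℕ => r ^ k • a k) 0 := by
    intro r hr
    have hq : ‖(r : ℂ) * z‖ < 1 := by rwa [norm_mul, Complex.norm_real]
    have hterm : ∀ k : ℕ, ∫ w, (((r * z) * (starRingEnd ℂ) w) ^ k / k).re ∂μ = r ^ k • a k := by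
      intro k
      rw [ha, smul_eq_mul, ← integral_const_mul]
      congr 1
      ext w
      rw [mul_assoc, mul_pow, mul_div_assoc, ← Complex.ofReal_pow, Complex.re_ofReal_mul]
    have h1 := hasSum_integral_of_summable_integral_norm (μ := μ)
      (F := fun (k : ℕ) w => (((r * z) * (starRingEnd ℂ) w) ^ k / k).re) (fun k => (hint k _).re) ?_
    · simp_rw [hterm] at h1
      suffices hzero : ∫ w, ∑' k : ℕ, (((r * z) * (starRingEnd ℂ) w) ^ k / k).re ∂μ = 0 by
        rw [hzero] at h1
        exact h1
      rw [← neg_zero, ← h _ hq, potential, ← integral_neg]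
      refine integral_congr_ae (hae.mono fun w hw => ?_)
      have hw1 : ‖((r : ℂ) * z) * (starRingEnd ℂ) w‖ < 1 := by
        rwa [norm_mul, RCLike.norm_conj, hw, mul_one]
      have h2 := (Complex.hasSum_re (Complex.hasSum_taylorSeries_neg_log hw1)).tsum_eq
      beta_reduce
      rw [h2, Complex.neg_re, Complex.log_re]
      congr 2
      symm
      have hww : w * (starRingEnd ℂ) w = 1 := by
        rw [Complex.mul_conj, Complex.normSq_eq_norm_sq, hw]; simp
      calc ‖(r : ℂ) * z - w‖ = ‖(r : ℂ) * z - w‖ * ‖(starRingEnd ℂ) w‖ := by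
            rw [RCLike.norm_conj, hw, mul_one]
        _ = ‖1 - (r : ℂ) * z * (starRingEnd ℂ) w‖ := by
            rw [← norm_mul, sub_mul, hww, norm_sub_rev]
    · refine Summable.of_nonneg_of_le (fun k => integral_nonneg fun w => norm_nonneg _)
        (fun k => ?_) (summable_geometric_of_lt_one (norm_nonneg _) hq)
      have : ∫ _ : ℂ, ‖(r : ℂ) * z‖ ^ k ∂μ = ‖(r : ℂ) * z‖ ^ k := by simp
      rw [← this]
      refine integral_mono_ae (hint k _).re.norm (integrable_const _) (hae.mono fun w hw => ?_)
      refine (Complex.abs_re_le_norm _).trans ?_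
      rw [norm_div, norm_pow, norm_mul _ ((starRingEnd ℂ) w), RCLike.norm_conj, hw, mul_one,
        Complex.norm_natCast]
      rcases Nat.eq_zero_or_pos k with rfl | hk
      · simp
      · exact div_le_self (by positivity) (by exact_mod_cast hk)
  have hps : HasFPowerSeriesAt (0 : ℝ → ℝ) (FormalMultilinearSeries.ofScalars ℝ a) 0 := by
    rw [hasFPowerSeriesAt_iff]
    have hcont : ContinuousAt (fun r : ℝ => |r| * ‖z‖) 0 := by fun_prop
    have : ∀ᶠ r : ℝ in 𝓝 0, |r| * ‖z‖ < 1 :=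
      hcont.eventually_lt continuousAt_const (by simp)
    filter_upwards [this] with r hr
    simpa [FormalMultilinearSeries.coeff_ofScalars] using hsum r hr
  have han : a n = 0 := by
    have := congrArg (fun p => FormalMultilinearSeries.coeff p n) hps.eq_zero
    beta_reduce at this
    rwa [FormalMultilinearSeries.coeff_ofScalars] at this
  have hre : a n = (∫ w, (z * (starRingEnd ℂ) w) ^ n / n ∂μ).re := integral_re (hint n z)
  have hval : ∫ w, (z * (starRingEnd ℂ) w) ^ n / n ∂μ
      = ((‖∫ w, w ^ n ∂μ‖ ^ 2 / n : ℝ) : ℂ) := by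
    simp_rw [mul_pow, ← map_pow]
    rw [integral_div, integral_const_mul, integral_conj, hz, Complex.mul_conj,
      Complex.normSq_eq_norm_sq]
    push_cast
    rfl
  rw [hval, Complex.ofReal_re, han] at hre
  have hn' : (n : ℝ) ≠ 0 := by exact_mod_cast hn
  have : ‖∫ w, w ^ n ∂μ‖ ^ 2 = 0 := by
    have := hre.symm
    rwa [div_eq_zero_iff, or_iff_left hn'] at this
  simpa using this

/-- A finite measure on the unit circle is determined by its moments. -/
theorem ext_of_integral_pow {μ ν : Measure ℂ} [IsFiniteMeasure μ] [IsFiniteMeasure ν]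
    (hμ : ∀ᵐ w ∂μ, ‖w‖ = 1) (hν : ∀ᵐ w ∂ν, ‖w‖ = 1)
    (h : ∀ n : ℕ, ∫ w, w ^ n ∂μ = ∫ w, w ^ n ∂ν) : μ = ν := by
  have : Fact (0 < 2 * Real.pi) := ⟨Real.two_pi_pos⟩
  -- The argument transports the measures to `AddCircle`, where trigonometric polynomials are
  -- available; `fourier 1` inverts it on the circle.
  let τ : ℂ → AddCircle (2 * Real.pi) := fun w => (Complex.arg w : AddCircle (2 * Real.pi))
  have hτ : Measurable τ := AddCircle.measurable_mk'.comp Complex.measurable_arg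
  have hfour : ∀ (n : ℕ) (w : ℂ), ‖w‖ = 1 → fourier (n : ℤ) (τ w) = w ^ n := by
    intro n w hw
    have hpi : (Real.pi : ℂ) ≠ 0 := by exact_mod_cast Real.pi_ne_zero
    have h1 := Complex.norm_mul_exp_arg_mul_I w
    rw [hw, Complex.ofReal_one, one_mul] at h1
    rw [fourier_coe_apply]
    nth_rewrite 2 [← h1]
    rw [← Complex.exp_nat_mul]
    congr 1
    push_cast
    field_simp
  have hrec : ∀ σ : Measure ℂ, (∀ᵐ w ∂σ, ‖w‖ = 1) →
      (σ.map τ).map (fourier (T := 2 * Real.pi) 1) = σ := by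
    intro σ hσ
    rw [Measure.map_map (fourier 1).continuous.measurable hτ]
    conv_rhs => rw [← Measure.map_id (μ := σ)]
    refine Measure.map_congr (hσ.mono fun w hw => ?_)
    have := hfour 1 w hw
    simpa using this
  have hnat : ∀ n : ℕ, ∫ x, fourier (n : ℤ) x ∂(μ.map τ) = ∫ x, fourier (n : ℤ) x ∂(ν.map τ) := by
    intro n
    rw [integral_map hτ.aemeasurable (fourier (n : ℤ)).continuous.aestronglyMeasurable,
      integral_map hτ.aemeasurable (fourier (n : ℤ)).continuous.aestronglyMeasurable,
      integral_congr_ae (hμ.mono fun w hw => hfour n w hw),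
      integral_congr_ae (hν.mono fun w hw => hfour n w hw), h n]
  -- Negative frequencies are conjugates of positive ones, as the measures are real.
  have hint : ∀ n : ℤ, ∫ x, fourier n x ∂(μ.map τ) = ∫ x, fourier n x ∂(ν.map τ) := by
    intro n
    obtain ⟨k, rfl | rfl⟩ := n.eq_nat_or_neg
    · exact hnat k
    · simp_rw [fourier_neg]
      rw [integral_conj, integral_conj, hnat k]
  have hmap : μ.map τ = ν.map τ := by
    refine ext_of_forall_mem_subalgebra_integral_eq_of_pseudoEMetric_complete_countable (𝕜 := ℂ)
      (A := (fourierSubalgebra (T := 2 * Real.pi)).comap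
        (BoundedContinuousFunction.toContinuousMapStarₐ ℂ)) ?_ ?_
    · intro x y hxy
      obtain ⟨_, ⟨f, hf, rfl⟩, hne⟩ := fourierSubalgebra_separatesPoints hxy
      refine ⟨f, ⟨f, ⟨BoundedContinuousFunction.mkOfCompact f, ?_, ?_⟩, rfl⟩, hne⟩
      · exact hf
      · ext; rfl
    · intro g hg
      have hg' : (g : C(AddCircle (2 * Real.pi), ℂ)) ∈
          Submodule.span ℂ (range (fourier (T := 2 * Real.pi))) := by
        rw [← fourierSubalgebra_coe]
        exact hg
      have hi : ∀ (σ : Measure (AddCircle (2 * Real.pi))) [IsFiniteMeasure σ]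
          (f : C(AddCircle (2 * Real.pi), ℂ)), Integrable f σ := fun σ _ f =>
        (BoundedContinuousFunction.mkOfCompact f).integrable σ
      suffices ∀ f ∈ Submodule.span ℂ (range (fourier (T := 2 * Real.pi))),
          ∫ x, f x ∂(μ.map τ) = ∫ x, f x ∂(ν.map τ) from this _ hg'
      intro f hf
      induction hf using Submodule.span_induction with
      | mem f hf => obtain ⟨n, rfl⟩ := hf; exact hint n
      | zero => simp
      | add f₁ f₂ _ _ h1 h2 =>
        simp only [ContinuousMap.add_apply]
        rw [integral_add (hi _ f₁) (hi _ f₂), integral_add (hi _ f₁) (hi _ f₂), h1, h2]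
      | smul a f _ h1 =>
        simp only [ContinuousMap.smul_apply]
        rw [integral_smul, integral_smul, h1]
  rw [← hrec μ hμ, ← hrec ν hν, hmap]

/-- Some equilibrium measure exists and has energy `0`, which arc length attains. -/
theorem isEquilibriumMeasure_arcMeasure :
    IsEquilibriumMeasure (Metric.sphere (0 : ℂ) 1) arcMeasure := by
  refine ⟨isProbabilityMeasure_arcMeasure, compactlySupportedIn_arcMeasure, fun ν hν hνS => ?_⟩
  have h := isEquilibriumMeasure_equilibriumMeasure (isCompact_sphere 0 1) not_isPolar_sphere
  rw [energy_arcMeasure, ← h.energy_sphere.1]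
  exact h.2.2 ν hν hνS

theorem IsEquilibriumMeasure.ae_norm_eq_one {μ : Measure ℂ}
    (hμ : IsEquilibriumMeasure (Metric.sphere (0 : ℂ) 1) μ) : ∀ᵐ w ∂μ, ‖w‖ = 1 := by
  have hae : ∀ᵐ w ∂μ, w ∈ Metric.sphere (0 : ℂ) 1 :=
    (compactlySupportedIn_iff (isCompact_sphere 0 1) μ).1 hμ.2.1
  exact hae.mono fun w hw => mem_sphere_zero_iff_norm.1 hw

/-- The equilibrium measure of the unit circle is unique. -/
theorem IsEquilibriumMeasure.eq_of_sphere {μ ν : Measure ℂ}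
    (hμ : IsEquilibriumMeasure (Metric.sphere (0 : ℂ) 1) μ)
    (hν : IsEquilibriumMeasure (Metric.sphere (0 : ℂ) 1) ν) : μ = ν := by
  have := hμ.1
  have := hν.1
  refine ext_of_integral_pow hμ.ae_norm_eq_one hν.ae_norm_eq_one fun n => ?_
  rcases eq_or_ne n 0 with rfl | hn
  · simp
  · rw [integral_pow_eq_zero hμ.ae_norm_eq_one hμ.energy_sphere.2 hn,
      integral_pow_eq_zero hν.ae_norm_eq_one hν.energy_sphere.2 hn]

theorem equilibriumMeasure_sphere : equilibriumMeasure (Metric.sphere (0 : ℂ) 1) = arcMeasure :=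
  (isEquilibriumMeasure_equilibriumMeasure (isCompact_sphere 0 1) not_isPolar_sphere).eq_of_sphere
    isEquilibriumMeasure_arcMeasure

theorem widomFactor_arcMeasure (n : ℕ) : widomFactor n arcMeasure = 1 := by
  have hE := isEquilibriumMeasure_arcMeasure
  have := hE.1
  refine le_antisymm ?_ (hE.one_le_widomFactor (isCompact_sphere 0 1) not_isPolar_sphere n)
  rw [widomFactor, hE.support.capacity_eq, energy_arcMeasure, EReal.exp_zero, one_pow, div_one]
  refine ((isMonicMinimizer_orthoPoly hE.2.1.1 n).2.2 (X ^ n) (monic_X_pow n)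
    (natDegree_X_pow n)).trans (le_of_eq ?_)
  have h1 : eLpNorm (fun z : ℂ => (X ^ n : ℂ[X]).eval z) 2 arcMeasure
      = eLpNorm (fun _ : ℂ => (1 : ℝ)) 2 arcMeasure :=
    eLpNorm_congr_norm_ae (hE.ae_norm_eq_one.mono fun w hw => by simp [hw])
  rw [polyNorm, h1, eLpNorm_const _ two_ne_zero (IsProbabilityMeasure.ne_zero _)]
  simp

end LogPotential

theorem corollary1p4 :
    (∀ K : Set ℂ, IsCompact K → ¬ LogPotential.IsPolar K →
      (1 ≤ ⨅ n : ℕ, LogPotential.widomFactor n (LogPotential.equilibriumMeasure K)) ∧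
      ∀ n : ℕ, LogPotential.capacity K ^ n ≤
        LogPotential.polyNorm
          (LogPotential.orthoPoly n (LogPotential.equilibriumMeasure K))
          (LogPotential.equilibriumMeasure K)) ∧
    (¬ LogPotential.IsPolar (Metric.sphere (0 : ℂ) 1) ∧
      LogPotential.equilibriumMeasure (Metric.sphere (0 : ℂ) 1) = LogPotential.arcMeasure ∧
      ∀ n : ℕ, LogPotential.widomFactor n
        (LogPotential.equilibriumMeasure (Metric.sphere (0 : ℂ) 1)) = 1) := by
  refine ⟨fun K hK hp => ?_, LogPotential.not_isPolar_sphere,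
    LogPotential.equilibriumMeasure_sphere, fun n => ?_⟩
  · have h := LogPotential.isEquilibriumMeasure_equilibriumMeasure hK hp
    exact ⟨le_iInf fun n => h.one_le_widomFactor hK hp n, fun n => h.capacity_pow_le hK hp n⟩
  · rw [LogPotential.equilibriumMeasure_sphere]
    exact LogPotential.widomFactor_arcMeasure n
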